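/- Let $M$ be an oriented matroid on a finite linearly ordered set $E$. For $A\subseteq E$ let $-_AM$ be the reorientation of $M$ along $A$; reorientations of $M$ are identified with the subsets $A\subseteq E$ (so there are $2^{|E|}$ of them). For $F\subseteq G\subseteq E$ let $M(G)/F$ be the minor obtained by restricting to $G$ and contracting $F$; write $-_AM(G)/F$ for $(-_AM)(G)/F$. A positive (co)circuit is a signed (co)circuit all of whose signs are positive; (co)circuits are identified with their supports below. An oriented matroid $N$ is bounded with respect to an element $p$ if it has no positive circuit and every positive cocircuit contains $p$; it is dual-bounded with respect to $p$ if every element lies in a positive circuit and every positive circuit contains $p$. A connected filtration of $M$ is a sequence $(F'_\varepsilon,\dots,F'_0,F_c,F_0,\dots,F_\iota)$ of subsets of $E$ ($\varepsilon,\iota\ge 0$) such that $\emptyset=F'_\varepsilon\subsetneq\dots\subsetneq F'_0=F_c=F_0\subsetneq\dots\subsetneq F_\iota=E$; the sequences $\min(F_k\setminus F_{k-1})$, $1\le k\le\iota$, and $\min(F'_{k-1}\setminus F'_k)$, $1\le k\le\varepsilon$, are increasing in $k$; for $1\le k\le\iota$ the matroid underlying $M(F_k)/F_{k-1}$ is connected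 and is not a single loop; and for $1\le k\le\varepsilon$ the matroid underlying $M(F'_{k-1})/F'_k$ is connected and is not a single isthmus (coloop). The active filtration of an oriented matroid $N$ on $E$ is defined as follows. Let $a_1<\dots<a_\iota$ be the elements of $E$ that are the minimum of some positive cocircuit of $N$, and $a'_1<\dots<a'_\varepsilon$ those that are the minimum of some positive circuit of $N$. Then $F_c$ is the union of all positive circuits of $N$; $F'_k$ is the union of all positive circuits $C$ with $\min C\ge a'_{k+1}$ for $0\le k<\varepsilon$, and $F'_\varepsilon=\emptyset$; $F_k$ is the complement in $E$ of the union of all positive cocircuits $D$ with $\min D\ge a_{k+1}$ for $0\le k<\iota$, and $F_\iota=E$. Theorem. One has $$\bigl\{-_AM : A\subseteq E\bigr\}=\biguplus\Bigl\{-_AM \;:\; -_AM(F_k)/F_{k-1}\text{ is bounded with respect to }\min(F_k\setminus F_{k-1})\text{ for }1\le k\le\iota,\ \text{and } -_AM(F'_{k-1})/F'_k\text{ is dual-bounded with respect to }\min(F'_{k-1}\setminus F'_k)\text{ for }1\le k\le\varepsilon\Bigr\},$$ where the disjoint union is over all connected filtrations $(F'_\varepsilon,\dots,F'_0,F_c,F_0,\dots,F_\iota)$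 of $M$. Moreover, whenever $-_AM$ belongs to the set indexed by a connected filtration of $M$, this filtration is the active filtration of $-_AM$. -/

import Mathlib

/-- A signed subset of `α`: `X e` is `1`, `-1` or `0` according as `e` is a positive element, a
negative element, or not an element of the signed subset. -/
abbrev SignedSet (α : Type*) := α → SignType

namespace SignedSet

variable {α : Type*}

/-- The underlying (unsigned) set. -/
def supp (X : SignedSet α) : Set α := {e | X e ≠ 0}

/-- The separation set of two signed sets. -/
def sep (X Y : SignedSet α) : Set α := {e | X e ≠ 0 ∧ Y e = -X e}

/-- The composition `X ∘ Y`. -/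
def comp (X Y : SignedSet α) : SignedSet α := fun e => if X e = 0 then Y e else X e

/-- The restriction of a signed set to `F`. -/
def restr [DecidableEq α] (F : Finset α) (X : SignedSet α) : SignedSet α :=
  fun e => if e ∈ F then X e else 0

/-- The signed set obtained by reversing the signs of the elements of `A`. -/
def flip [DecidableEq α] (A : Finset α) (X : SignedSet α) : SignedSet α :=
  fun e => if e ∈ A then -X e else X e

/-- Orthogonality: either the supports are disjoint, or there are elements of the intersection
of the supports on which the signs agree and elements on which they are opposite. -/
def Orth (X Y : SignedSet α) : Prop :=
  (∃ e, X e * Y e = 1) ↔ (∃ e, X e * Y e = -1)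

/-- All signs are positive. -/
def IsPositive (X : SignedSet α) : Prop := ∀ e ∈ X.supp, X e = 1

end SignedSet

/-- An oriented matroid on a finite ground set, given by the covector axioms. -/
structure OrientedMatroid (α : Type*) where
  /-- the ground set `E` -/
  ground : Finset α
  /-- the set of covectors, which are signed subsets of `E` -/
  covectors : Set (SignedSet α)
  supp_subset : ∀ X ∈ covectors, X.supp ⊆ ground
  zero_mem : (0 : SignedSet α) ∈ covectors
  neg_mem : ∀ X ∈ covectors, -X ∈ covectors
  comp_mem : ∀ X ∈ covectors, ∀ Y ∈ covectors, X.comp Y ∈ covectors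
  elim : ∀ X ∈ covectors, ∀ Y ∈ covectors, ∀ e ∈ X.sep Y,
    ∃ Z ∈ covectors, Z e = 0 ∧ ∀ f ∉ X.sep Y, Z f = X.comp Y f

namespace OrientedMatroid

section Basic

variable {α : Type*}

/-- The vectors: signed subsets of `E` orthogonal to all the covectors. -/
def vectors (M : OrientedMatroid α) : Set (SignedSet α) :=
  {X | X.supp ⊆ M.ground ∧ ∀ Y ∈ M.covectors, X.Orth Y}

/-- The (signed) circuits: the nonzero vectors with inclusion-minimal support. -/
def IsCircuit (M : OrientedMatroid α) (C : SignedSet α) : Prop :=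
  C ∈ M.vectors ∧ C ≠ 0 ∧ ∀ X ∈ M.vectors, X ≠ 0 → X.supp ⊆ C.supp → X.supp = C.supp

/-- The (signed) cocircuits: the nonzero covectors with inclusion-minimal support. -/
def IsCocircuit (M : OrientedMatroid α) (D : SignedSet α) : Prop :=
  D ∈ M.covectors ∧ D ≠ 0 ∧ ∀ X ∈ M.covectors, X ≠ 0 → X.supp ⊆ D.supp → X.supp = D.supp

def IsPosCircuit (M : OrientedMatroid α) (C : SignedSet α) : Prop := M.IsCircuit C ∧ C.IsPositive

def IsPosCocircuit (M : OrientedMatroid α) (D : SignedSet α) : Prop :=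
  M.IsCocircuit D ∧ D.IsPositive

/-- No positive circuit. -/
def IsAcyclic (M : OrientedMatroid α) : Prop := ∀ C, ¬ M.IsPosCircuit C

/-- Every element belongs to a positive circuit. -/
def IsTotallyCyclic (M : OrientedMatroid α) : Prop :=
  ∀ e ∈ M.ground, ∃ C, M.IsPosCircuit C ∧ e ∈ C.supp

/-- `M` is bounded with respect to `p`. -/
def IsBoundedAt (M : OrientedMatroid α) (p : α) : Prop :=
  p ∈ M.ground ∧ M.IsAcyclic ∧ ∀ D, M.IsPosCocircuit D → p ∈ D.supp

/-- `M` is dual-bounded with respect to `p`. -/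
def IsDualBoundedAt (M : OrientedMatroid α) (p : α) : Prop :=
  p ∈ M.ground ∧ M.IsTotallyCyclic ∧ ∀ C, M.IsPosCircuit C → p ∈ C.supp

/-- The underlying matroid, whose circuits are the supports of the signed circuits, is connected:
any two distinct elements lie in a common circuit. -/
def IsConnected (M : OrientedMatroid α) : Prop :=
  ∀ e ∈ M.ground, ∀ f ∈ M.ground, e ≠ f → ∃ C, M.IsCircuit C ∧ e ∈ C.supp ∧ f ∈ C.supp

/-- `M` has a unique element, and this element is a loop. -/
def IsLoop (M : OrientedMatroid α) : Prop :=
  ∃ e, M.ground = {e} ∧ ∃ C, M.IsCircuit C ∧ C.supp = {e}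

/-- `M` has a unique element, and this element is an isthmus (coloop). -/
def IsIsthmus (M : OrientedMatroid α) : Prop :=
  ∃ e, M.ground = {e} ∧ ∃ D, M.IsCocircuit D ∧ D.supp = {e}

end Basic

section Operations

variable {α : Type*} [DecidableEq α]

/-- The reorientation `-_A M`. -/
def reorient (M : OrientedMatroid α) (A : Finset α) : OrientedMatroid α where
  ground := M.ground
  covectors := {X | X.flip A ∈ M.covectors}
  supp_subset X hX e he := by
    refine M.supp_subset _ hX ?_
    simp only [SignedSet.supp, Set.mem_ofPred_eq, SignedSet.flip] at he ⊢
    split_ifs <;> simpa using he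
  zero_mem := by
    have h : SignedSet.flip A (0 : SignedSet α) = 0 := by
      funext e; simp [SignedSet.flip]
    simpa [h] using M.zero_mem
  neg_mem X hX := by
    have h : SignedSet.flip A (-X) = -SignedSet.flip A X := by
      funext e; simp only [SignedSet.flip, Pi.neg_apply]; split_ifs <;> rfl
    simpa [h] using M.neg_mem _ hX
  comp_mem X hX Y hY := by
    have h : SignedSet.flip A (X.comp Y) = (X.flip A).comp (Y.flip A) := by
      funext e; simp only [SignedSet.flip, SignedSet.comp]; split_ifs <;> simp_all
    simpa [h] using M.comp_mem _ hX _ hY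
  elim X hX Y hY e he := by
    have hs : (X.flip A).sep (Y.flip A) = X.sep Y := by
      ext f; simp only [SignedSet.sep, SignedSet.flip, Set.mem_ofPred_eq]
      split_ifs <;> simp [neg_eq_iff_eq_neg]
    obtain ⟨Z, hZ, hZe, hZf⟩ := M.elim _ hX _ hY e (hs ▸ he)
    have hZZ : (Z.flip A).flip A = Z := by
      funext f; simp only [SignedSet.flip]; split_ifs <;> simp
    refine ⟨Z.flip A, by simpa [hZZ] using hZ, by simp [SignedSet.flip, hZe], fun f hf => ?_⟩
    have := hZf f (hs ▸ hf)
    simp only [SignedSet.flip, SignedSet.comp] at this ⊢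
    split_ifs at this ⊢ <;> simp_all

/-- The restriction `M(F)`, that is, the deletion of the elements outside `F`: its covectors are
the restrictions to `F` of the covectors of `M`. -/
def restrict (M : OrientedMatroid α) (F : Finset α) : OrientedMatroid α where
  ground := M.ground ∩ F
  covectors := SignedSet.restr F '' M.covectors
  supp_subset := by
    rintro _ ⟨X, hX, rfl⟩ e he
    simp only [SignedSet.supp, Set.mem_ofPred_eq, SignedSet.restr] at he
    split_ifs at he with h
    · exact Finset.mem_coe.2 (Finset.mem_inter.2 ⟨M.supp_subset X hX he, h⟩)
    · exact absurd rfl he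
  zero_mem := ⟨0, M.zero_mem, by funext e; simp [SignedSet.restr]⟩
  neg_mem := by
    rintro _ ⟨X, hX, rfl⟩
    refine ⟨-X, M.neg_mem X hX, ?_⟩
    funext e; simp only [SignedSet.restr, Pi.neg_apply]; split_ifs <;> rfl
  comp_mem := by
    rintro _ ⟨X, hX, rfl⟩ _ ⟨Y, hY, rfl⟩
    refine ⟨X.comp Y, M.comp_mem X hX Y hY, ?_⟩
    funext e; simp only [SignedSet.restr, SignedSet.comp]; split_ifs <;> simp_all
  elim := by
    rintro _ ⟨X, hX, rfl⟩ _ ⟨Y, hY, rfl⟩ e he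
    have heF : e ∈ F := by
      by_contra h
      exact he.1 (by simp [SignedSet.restr, h])
    have he' : e ∈ X.sep Y := by
      simpa [SignedSet.sep, SignedSet.restr, heF] using he
    obtain ⟨Z, hZ, hZe, hZf⟩ := M.elim X hX Y hY e he'
    refine ⟨_, ⟨Z, hZ, rfl⟩, by simp [SignedSet.restr, hZe], fun f hf => ?_⟩
    by_cases hfF : f ∈ F
    · have hf' : f ∉ X.sep Y := by
        simpa [SignedSet.sep, SignedSet.restr, hfF] using hf
      simpa [SignedSet.restr, SignedSet.comp, hfF] using hZf f hf'
    · simp [SignedSet.restr, SignedSet.comp, hfF]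

/-- The contraction `M / F`: its covectors are the covectors of `M` that vanish on `F`. -/
def contract (M : OrientedMatroid α) (F : Finset α) : OrientedMatroid α where
  ground := M.ground \ F
  covectors := {X | X ∈ M.covectors ∧ ∀ e ∈ F, X e = 0}
  supp_subset := by
    rintro X ⟨hX, h0⟩ e he
    exact Finset.mem_coe.2 (Finset.mem_sdiff.2 ⟨M.supp_subset X hX he, fun h => he (h0 e h)⟩)
  zero_mem := ⟨M.zero_mem, fun _ _ => rfl⟩
  neg_mem := by
    rintro X ⟨hX, h0⟩
    exact ⟨M.neg_mem X hX, fun e he => by simp [h0 e he]⟩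
  comp_mem := by
    rintro X ⟨hX, hX0⟩ Y ⟨hY, hY0⟩
    exact ⟨M.comp_mem X hX Y hY, fun e he => by simp [SignedSet.comp, hX0 e he, hY0 e he]⟩
  elim := by
    rintro X ⟨hX, hX0⟩ Y ⟨hY, hY0⟩ e he
    obtain ⟨Z, hZ, hZe, hZf⟩ := M.elim X hX Y hY e he
    refine ⟨Z, ⟨hZ, fun f hf => ?_⟩, hZe, hZf⟩
    rw [hZf f (fun h => h.1 (hX0 f hf))]
    simp [SignedSet.comp, hX0 f hf, hY0 f hf]

/-- The minor `M(G) / F`. -/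
def minor (M : OrientedMatroid α) (G F : Finset α) : OrientedMatroid α :=
  (M.restrict G).contract F

end Operations

end OrientedMatroid

/-- A sequence of sets `(F'_ε, …, F'_0, F_c, F_0, …, F_ι)`; `F' k` stands for `F'_k` and `F k`
for `F_k`. -/
structure SetSeq (α : Type*) where
  ε : ℕ
  ι : ℕ
  F' : Fin (ε + 1) → Finset α
  Fc : Finset α
  F : Fin (ι + 1) → Finset α

namespace SetSeq

variable {α : Type*} [DecidableEq α]

/-- The part `F_k \ F_{k-1}`, with `k : Fin ι` standing for the index `k + 1` in `1, …, ι`. -/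
def part (S : SetSeq α) (k : Fin S.ι) : Finset α := S.F k.succ \ S.F k.castSucc

/-- The part `F'_{k-1} \ F'_k`, with `k : Fin ε` standing for the index `k + 1` in `1, …, ε`. -/
def part' (S : SetSeq α) (k : Fin S.ε) : Finset α := S.F' k.castSucc \ S.F' k.succ

end SetSeq

namespace OrientedMatroid

variable {α : Type*} [LinearOrder α]

/-- `S` is a filtration of (the ground set of) `M`:
`∅ = F'_ε ⊂ … ⊂ F'_0 = F_c = F_0 ⊂ … ⊂ F_ι = E`, and the minima of the successive differences
`F_k \ F_{k-1}`, and those of `F'_{k-1} \ F'_k`, increase with `k`. -/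
structure IsFiltration (M : OrientedMatroid α) (S : SetSeq α) : Prop where
  F'_last : S.F' (Fin.last S.ε) = ∅
  F'_strictAnti : StrictAnti S.F'
  F'_zero : S.F' 0 = S.Fc
  F_zero : S.F 0 = S.Fc
  F_strictMono : StrictMono S.F
  F_last : S.F (Fin.last S.ι) = M.ground
  min_part : StrictMono fun k : Fin S.ι => (S.part k).min
  min_part' : StrictMono fun k : Fin S.ε => (S.part' k).min

/-- `S` is a connected filtration of `M`. -/
structure IsConnectedFiltration (M : OrientedMatroid α) (S : SetSeq α) : Prop
    extends M.IsFiltration S where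
  connected : ∀ k : Fin S.ι, (M.minor (S.F k.succ) (S.F k.castSucc)).IsConnected ∧
    ¬ (M.minor (S.F k.succ) (S.F k.castSucc)).IsLoop
  connected' : ∀ k : Fin S.ε, (M.minor (S.F' k.castSucc) (S.F' k.succ)).IsConnected ∧
    ¬ (M.minor (S.F' k.castSucc) (S.F' k.succ)).IsIsthmus

/-- The minors `M(F_k) / F_{k-1}` are bounded with respect to `min (F_k \ F_{k-1})`, and the minors
`M(F'_{k-1}) / F'_k` are dual-bounded with respect to `min (F'_{k-1} \ F'_k)`. -/
def HasBoundedMinors (M : OrientedMatroid α) (S : SetSeq α) : Prop :=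
  (∀ k : Fin S.ι, ∃ p : α, (S.part k).min = p ∧
    (M.minor (S.F k.succ) (S.F k.castSucc)).IsBoundedAt p) ∧
  (∀ k : Fin S.ε, ∃ p : α, (S.part' k).min = p ∧
    (M.minor (S.F' k.castSucc) (S.F' k.succ)).IsDualBoundedAt p)

open Classical in
/-- The set `O(M)` of active elements. -/
noncomputable def active (M : OrientedMatroid α) : Finset α :=
  M.ground.filter fun a => ∃ C, M.IsPosCircuit C ∧ IsLeast C.supp a

open Classical in
/-- The set `O*(M)` of dual-active elements. -/
noncomputable def dualActive (M : OrientedMatroid α) : Finset α :=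
  M.ground.filter fun a => ∃ D, M.IsPosCocircuit D ∧ IsLeast D.supp a

open Classical in
/-- The union of the positive circuits. -/
noncomputable def cyclicPart (M : OrientedMatroid α) : Finset α :=
  M.ground.filter fun e => ∃ C, M.IsPosCircuit C ∧ e ∈ C.supp

open Classical in
/-- The union of the positive circuits whose smallest element is at least `a`. -/
noncomputable def circuitUnion (M : OrientedMatroid α) (a : α) : Finset α :=
  M.ground.filter fun e => ∃ C, M.IsPosCircuit C ∧ (∀ x ∈ C.supp, a ≤ x) ∧ e ∈ C.supp

open Classical in
/-- The union of the positive cocircuits whose smallest element is at least `a`. -/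
noncomputable def cocircuitUnion (M : OrientedMatroid α) (a : α) : Finset α :=
  M.ground.filter fun e => ∃ D, M.IsPosCocircuit D ∧ (∀ x ∈ D.supp, a ≤ x) ∧ e ∈ D.supp

/-- The active filtration of `M`. With `a_1 < … < a_ι` the dual-active and `a'_1 < … < a'_ε` the
active elements (enumerated from index `0` by `Finset.orderEmbOfFin`): `F'_k` for `k < ε` is the
union of the positive circuits with minimum at least `a'_{k+1}`, `F'_ε = ∅`, `F_c` is the union of
all the positive circuits, `F_k` for `k < ι` is the complement of the union of the positive
cocircuits with minimum at least `a_{k+1}`, and `F_ι = E`. -/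
noncomputable def activeFiltration (M : OrientedMatroid α) : SetSeq α where
  ε := M.active.card
  ι := M.dualActive.card
  F' k := if h : (k : ℕ) < M.active.card then
      M.circuitUnion (M.active.orderEmbOfFin rfl ⟨k, h⟩)
    else ∅
  Fc := M.cyclicPart
  F k := if h : (k : ℕ) < M.dualActive.card then
      M.ground \ M.cocircuitUnion (M.dualActive.orderEmbOfFin rfl ⟨k, h⟩)
    else M.ground

/-- The set of reorientations `-_A M` of `M`. A reorientation is identified with the subset
`A` of the ground set, so that there are `2 ^ |E|` of them. -/
def reorientations (M : OrientedMatroid α) : Set (Finset α) := {A | A ⊆ M.ground}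

/-- The reorientations `-_A M` whose minors induced by `S` are bounded, respectively dual-bounded,
with respect to their smallest elements. -/
def boundedReorientations (M : OrientedMatroid α) (S : SetSeq α) : Set (Finset α) :=
  {A | A ∈ M.reorientations ∧ (M.reorient A).HasBoundedMinors S}

end OrientedMatroid

/-
The sets `U_k = E \ F_k` and, for the dual, `U_k = F'_k` are supports of positive covectors, so both
halves of a filtration with bounded minors are instances of one kind of chain of positive supports,
applied to `M` and to `M*`. Contracting and deleting, the minor between `U_{k+1}` and `U_k` is
bounded at `p` if and only if `U_k` is a positive support and every positive support `W` with
`U_{k+1} ⊂ W ⊆ U_k` contains `p`. Hence, if `U_0` contains all positive supports, `U_k` is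
forced to be the largest positive support with minimum at least `min (U_k \ U_{k+1})`, and
these minima are exactly the minima of positive cocircuits; conversely those largest supports form
such a chain. Minty's theorem, that every element lies in exactly one of a positive circuit and a
positive cocircuit, makes the two chains meet at `F_c`. Connectedness comes for free: a positive
support can be restricted to a union of connected components, so a bounded minor is connected.
-/

namespace SignedSet

variable {α : Type*} {X Y : SignedSet α} {e : α}

theorem mem_supp : e ∈ X.supp ↔ X e ≠ 0 := Iff.rfl

theorem supp_neg (X : SignedSet α) : (-X).supp = X.supp := by
  ext e; simp [supp]

theorem supp_eq_empty_iff : X.supp = ∅ ↔ X = 0 := by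
  simp [Set.eq_empty_iff_forall_notMem, supp, funext_iff]

theorem supp_comp (X Y : SignedSet α) : (X.comp Y).supp = X.supp ∪ Y.supp := by
  ext e
  by_cases h : X e = 0 <;> simp [supp, comp, h]

theorem comp_of_eq_zero (h : X e = 0) : X.comp Y e = Y e := if_pos h

theorem comp_of_ne_zero (h : X e ≠ 0) : X.comp Y e = X e := if_neg h

theorem isPositive_iff : X.IsPositive ↔ ∀ e, X e = 0 ∨ X e = 1 :=
  forall_congr' fun e => by simp only [mem_supp]; tauto

theorem IsPositive.comp (hX : X.IsPositive) (hY : Y.IsPositive) : (X.comp Y).IsPositive := by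
  rw [isPositive_iff] at *
  intro e
  by_cases h : X e = 0
  · simpa only [comp_of_eq_zero h] using hY e
  · simpa only [comp_of_ne_zero h] using hX e

theorem mul_ne_neg_one_iff {x y : SignType} (hx : x ≠ 0) : x * y ≠ -1 ↔ y = 0 ∨ y = x := by
  revert x y; decide

theorem eq_or_eq_neg_of_ne_zero {x y : SignType} (hx : x ≠ 0) (hy : y ≠ 0) : y = x ∨ y = -x := by
  revert x y; decide

theorem mul_self_eq_one {x : SignType} (hx : x ≠ 0) : x * x = 1 := by
  revert x; decide

theorem orth_comm : X.Orth Y ↔ Y.Orth X := by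
  simp only [Orth, mul_comm]

theorem orth_congr {X' Y' : SignedSet α} (h : ∀ e, X e * Y e = X' e * Y' e) :
    X.Orth Y ↔ X'.Orth Y' := by
  simp only [Orth, h]

theorem Orth.mul_eq_zero (h : X.Orth Y) (hn : ∀ e, X e * Y e ≠ -1) (e : α) : X e * Y e = 0 := by
  have h1 : X e * Y e ≠ 1 := fun he => let ⟨f, hf⟩ := h.1 ⟨e, he⟩; hn f hf
  have h2 := hn e
  generalize X e * Y e = x at h1 h2 ⊢
  revert x; decide

theorem Orth.exists_ne (h : X.Orth Y) (hX : X e ≠ 0) (hY : Y e ≠ 0) :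
    ∃ f, f ≠ e ∧ X f ≠ 0 ∧ Y f ≠ 0 := by
  by_contra! hcon
  have huniq : ∀ f, X f * Y f ≠ 0 → f = e := fun f hf => by
    by_contra hfe
    exact hf (by rw [hcon f hfe (left_ne_zero_of_mul hf), mul_zero])
  rcases eq_or_eq_neg_of_ne_zero hX hY with he | he
  · obtain ⟨f, hf⟩ := h.1 ⟨e, by rw [he, mul_self_eq_one hX]⟩
    rw [huniq f (by simp [hf]), he, mul_self_eq_one hX] at hf
    exact absurd hf (by decide)
  · obtain ⟨f, hf⟩ := h.2 ⟨e, by rw [he, mul_neg, mul_self_eq_one hX]⟩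
    rw [huniq f (by simp [hf]), he, mul_neg, mul_self_eq_one hX] at hf
    exact absurd hf (by decide)

theorem Orth.mul_eq_zero_of_notMem_sep {D : SignedSet α} (hX : X.Orth D) (hY : Y.Orth D)
    (he : e ∈ X.sep Y) (hsep : ∀ f ∈ X.sep Y, f ≠ e → D f = 0)
    (hn : ∀ f ∉ X.sep Y, X.comp Y f * D f ≠ -1) : ∀ f ∉ X.sep Y, X.comp Y f * D f = 0 := by
  have hXD : ∀ f, f ≠ e → X f * D f ≠ -1 := fun f hfe => by
    by_cases hf : f ∈ X.sep Y
    · simp [hsep f hf hfe]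
    by_cases h : X f = 0
    · simp [h]
    · simpa only [comp_of_ne_zero h] using hn f hf
  have hYD : ∀ f, f ≠ e → Y f * D f ≠ -1 := fun f hfe => by
    by_cases hf : f ∈ X.sep Y
    · simp [hsep f hf hfe]
    by_cases hX0 : X f = 0
    · simpa only [comp_of_eq_zero hX0] using hn f hf
    by_cases hY0 : Y f = 0
    · simp [hY0]
    · rw [(eq_or_eq_neg_of_ne_zero hX0 hY0).resolve_right fun h => hf ⟨hX0, h⟩]
      simpa only [comp_of_ne_zero hX0] using hn f hf
  have hX_all : X e * D e ≠ -1 → ∀ f, X f * D f = 0 := fun h =>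
    hX.mul_eq_zero fun f => (eq_or_ne f e).elim (fun hfe => hfe ▸ h) (hXD f)
  have hY_all : Y e * D e ≠ -1 → ∀ f, Y f * D f = 0 := fun h =>
    hY.mul_eq_zero fun f => (eq_or_ne f e).elim (fun hfe => hfe ▸ h) (hYD f)
  have hDe : D e = 0 := by
    by_cases h : X e * D e = -1
    · have hYe : Y e * D e = 1 := by rw [he.2, neg_mul, h, neg_neg]
      exact absurd (hY_all (by rw [hYe]; decide) e) (by rw [hYe]; decide)
    · exact (_root_.mul_eq_zero.1 (hX_all h e)).resolve_left he.1
  intro f _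
  simp only [comp]
  split_ifs
  exacts [hY_all (by simp [hDe]) f, hX_all (by simp [hDe]) f]

/-- The conformal order on signed sets: `X` is obtained from `Y` by replacing some signs by
zero. -/
def Conforms (X Y : SignedSet α) : Prop := ∀ e, X e = 0 ∨ X e = Y e

theorem Conforms.trans {Z : SignedSet α} (h : X.Conforms Y) (h' : Y.Conforms Z) :
    X.Conforms Z := fun e => by
  rcases h e with he | he
  · exact Or.inl he
  · rw [he]; exact h' e

theorem Conforms.comp {Z : SignedSet α} (hX : X.Conforms Z) (hY : Y.Conforms Z) :
    (X.comp Y).Conforms Z := fun e => by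
  by_cases h : X e = 0
  · simpa only [comp_of_eq_zero h] using hY e
  · simpa only [comp_of_ne_zero h] using hX e

theorem Conforms.supp_subset (h : X.Conforms Y) : X.supp ⊆ Y.supp := fun e he => by
  rwa [mem_supp, ← (h e).resolve_left he]

theorem Conforms.isPositive (h : X.Conforms Y) (hY : Y.IsPositive) : X.IsPositive := fun e he => by
  rw [(h e).resolve_left he, hY e (h.supp_subset he)]

section Flip

variable [DecidableEq α] {A : Finset α}

theorem flip_involutive (A : Finset α) : Function.Involutive (flip A) := fun X => by
  funext e
  simp only [flip]
  split_ifs <;> simp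

theorem flip_eq_zero_iff : X.flip A e = 0 ↔ X e = 0 := by
  simp only [flip]
  split_ifs <;> simp

theorem supp_flip (A : Finset α) (X : SignedSet α) : (X.flip A).supp = X.supp :=
  Set.ext fun _ => not_congr flip_eq_zero_iff

theorem flip_orth_flip : (X.flip A).Orth (Y.flip A) ↔ X.Orth Y := by
  refine orth_congr fun e => ?_
  simp only [flip]
  split_ifs <;> simp

theorem restr_flip (G A : Finset α) (X : SignedSet α) :
    restr G (X.flip A) = (restr G X).flip A := by
  funext e
  simp only [flip, restr]
  split_ifs <;> simp

end Flip

end SignedSet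

theorem SetSeq.eq_of_forall {α : Type*} {S T : SetSeq α} (hε : S.ε = T.ε) (hι : S.ι = T.ι)
    (hFc : S.Fc = T.Fc) (hF' : ∀ k, S.F' k = T.F' (Fin.cast (congrArg (· + 1) hε) k))
    (hF : ∀ k, S.F k = T.F (Fin.cast (congrArg (· + 1) hι) k)) : S = T := by
  obtain ⟨ε, ι, F', Fc, F⟩ := S
  obtain ⟨ε₂, ι₂, F'₂, Fc₂, F₂⟩ := T
  obtain rfl : ε = ε₂ := hε
  obtain rfl : ι = ι₂ := hι
  obtain rfl : Fc = Fc₂ := hFc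
  obtain rfl : F' = F'₂ := funext hF'
  obtain rfl : F = F₂ := funext hF
  rfl

namespace OrientedMatroid

open SignedSet

section Vectors

variable {α : Type*} {M N : OrientedMatroid α} {X Y : SignedSet α}

theorem ext_covectors (hg : M.ground = N.ground) (hc : M.covectors = N.covectors) : M = N := by
  cases M; cases N; congr

theorem apply_eq_zero_of_notMem (hX : X.supp ⊆ M.ground) {e : α} (he : e ∉ M.ground) :
    X e = 0 := by
  by_contra h
  exact he (hX h)

theorem mem_vectors_iff : X ∈ M.vectors ↔ X.supp ⊆ M.ground ∧
    ∀ Y ∈ M.covectors, (∀ e, X e * Y e ≠ -1) → ∀ e, X e * Y e = 0 := by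
  refine and_congr_right fun _ => ⟨fun h Y hY => (h Y hY).mul_eq_zero, fun h Y hY => ?_⟩
  have exists_neg : ∀ Z ∈ M.covectors, (∃ e, X e * Z e = 1) → ∃ e, X e * Z e = -1 :=
    fun Z hZ ⟨e, he⟩ => by
      by_contra! hcon
      simp [h Z hZ hcon e] at he
  refine ⟨exists_neg Y hY, fun ⟨e, he⟩ => ?_⟩
  obtain ⟨f, hf⟩ := exists_neg (-Y) (M.neg_mem Y hY) ⟨e, by simp [he]⟩
  exact ⟨f, by simpa using hf⟩

theorem neg_mem_vectors (hX : X ∈ M.vectors) : -X ∈ M.vectors :=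
  ⟨by rw [supp_neg]; exact hX.1, fun Y hY => by
    rw [orth_congr (X' := X) (Y' := -Y) (by simp)]
    exact hX.2 _ (M.neg_mem Y hY)⟩

theorem comp_mem_vectors (hX : X ∈ M.vectors) (hY : Y ∈ M.vectors) : X.comp Y ∈ M.vectors := by
  refine mem_vectors_iff.2 ⟨supp_comp X Y ▸ Set.union_subset hX.1 hY.1, fun Z hZ hn => ?_⟩
  have hXZ : ∀ e, X e * Z e = 0 := (hX.2 Z hZ).mul_eq_zero fun e => by
    by_cases h : X e = 0
    · simp [h]
    · simpa only [comp_of_ne_zero h] using hn e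
  have hYZ : ∀ e, Y e * Z e = 0 := (hY.2 Z hZ).mul_eq_zero fun e => by
    by_cases h : X e = 0
    · simpa only [comp_of_eq_zero h] using hn e
    · simp [(mul_eq_zero.1 (hXZ e)).resolve_left h]
  intro e
  by_cases h : X e = 0
  · rw [comp_of_eq_zero h, hYZ]
  · rw [comp_of_ne_zero h, hXZ]

section Lift

variable [DecidableEq α]

theorem contract_contract (M : OrientedMatroid α) (A B : Finset α) :
    (M.contract A).contract B = M.contract (A ∪ B) := by
  refine ext_covectors (sdiff_sdiff ..) (Set.ext fun X => ?_)
  simp [contract, or_imp, forall_and, and_assoc]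

theorem exists_covector_of_update_notMem_vectors {b : α} {s : SignType}
    (hX : X ∈ (M.contract {b}).vectors) (hs : s ≠ 0 → b ∈ M.ground)
    (h : Function.update X b s ∉ M.vectors) :
    ∃ Y ∈ M.covectors, Y b ≠ 0 ∧ (∀ f, X f * Y f ≠ -1) ∧ s * Y b ≠ -1 ∧
      ∃ f, Function.update X b s f * Y f ≠ 0 := by
  obtain ⟨hXs, hX⟩ := mem_vectors_iff.1 hX
  have hXb : X b = 0 := apply_eq_zero_of_notMem hXs (by simp [contract])
  rw [mem_vectors_iff] at h
  push Not at h
  obtain ⟨Y, hY, hn, e, he⟩ := h fun f hf => by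
    rcases eq_or_ne f b with rfl | hfb
    · exact hs (by simpa [supp] using hf)
    · exact (Finset.mem_sdiff.1 (hXs (by simpa [supp, hfb] using hf))).1
  have hXY : ∀ f, X f * Y f ≠ -1 := fun f => by
    rcases eq_or_ne f b with rfl | hfb
    · simp [hXb]
    · simpa [hfb] using hn f
  refine ⟨Y, hY, fun hYb => he ?_, hXY, by simpa using hn b, e, he⟩
  rcases eq_or_ne e b with rfl | heb
  · rw [hYb, mul_zero]
  · rw [Function.update_of_ne heb, hX Y ⟨hY, by simpa using hYb⟩ hXY]

theorem exists_vector_of_contract_singleton {b : α} (hX : X ∈ (M.contract {b}).vectors) :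
    ∃ X' ∈ M.vectors, ∀ f, f ≠ b → X' f = X f := by
  have hXb : X b = 0 := apply_eq_zero_of_notMem hX.1 (by simp [contract])
  by_contra! hcon
  have hnot : ∀ s, Function.update X b s ∉ M.vectors := fun s h =>
    let ⟨_, hfb, hf⟩ := hcon _ h; hf (Function.update_of_ne hfb ..)
  -- Covectors witnessing that neither the value `0` nor the value `-Y₀ b` at `b` gives a vector
  -- have opposite signs at `b`; eliminating `b` between them contradicts `hX`.
  obtain ⟨Y₀, hY₀, hb₀, hn₀, -, e, he⟩ :=
    exists_covector_of_update_notMem_vectors hX (fun h => absurd rfl h) (hnot 0)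
  rw [Function.update_eq_self_iff.2 hXb.symm] at he
  obtain ⟨Y₁, hY₁, hb₁, hn₁, hn, -⟩ :=
    exists_covector_of_update_notMem_vectors hX (fun _ => M.supp_subset _ hY₀ hb₀) (hnot (-Y₀ b))
  have hb : Y₁ b = -Y₀ b := by
    revert hb₀ hb₁ hn
    generalize Y₀ b = x, Y₁ b = y
    revert x y; decide
  obtain ⟨Z, hZ, hZb, hZf⟩ := M.elim Y₀ hY₀ Y₁ hY₁ b ⟨hb₀, hb⟩
  have hXZ : ∀ f, X f ≠ 0 → Z f = Y₀.comp Y₁ f := fun f hf => hZf f fun ⟨h0, h1⟩ => by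
    have h0' := ((mul_ne_neg_one_iff hf).1 (hn₀ f)).resolve_left h0
    simpa [h1, h0', mul_self_eq_one hf] using hn₁ f
  have hnZ : ∀ f, X f * Z f ≠ -1 := fun f => by
    by_cases hf : X f = 0
    · simp [hf]
    rw [hXZ f hf, comp]
    split_ifs
    exacts [hn₁ f, hn₀ f]
  have h := (hX.2 Z ⟨hZ, by simpa using hZb⟩).mul_eq_zero hnZ e
  rw [hXZ e (left_ne_zero_of_mul he), comp_of_ne_zero (right_ne_zero_of_mul he)] at h
  exact he h

theorem exists_vector_of_contract (B : Finset α) (hX : X ∈ (M.contract B).vectors) :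
    ∃ X' ∈ M.vectors, ∀ f ∉ B, X' f = X f := by
  induction B using Finset.induction_on generalizing X with
  | empty => exact ⟨X, by simpa [vectors, contract] using hX, fun _ _ => rfl⟩
  | insert b B _ ih =>
    rw [Finset.insert_eq, Finset.union_comm, ← contract_contract] at hX
    obtain ⟨X₁, hX₁, h₁⟩ := exists_vector_of_contract_singleton hX
    obtain ⟨X₂, hX₂, h₂⟩ := ih hX₁
    refine ⟨X₂, hX₂, fun f hf => ?_⟩
    rw [Finset.mem_insert, not_or] at hf
    rw [h₂ f hf.2, h₁ f hf.1]

end Lift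

theorem elim_vectors (hX : X ∈ M.vectors) (hY : Y ∈ M.vectors) {e : α} (he : e ∈ X.sep Y) :
    ∃ Z ∈ M.vectors, Z e = 0 ∧ ∀ f ∉ X.sep Y, Z f = X.comp Y f := by
  classical
  let T := (M.ground.filter (· ∈ X.sep Y)).erase e
  have hT : ∀ f, f ∈ T ↔ f ≠ e ∧ f ∈ X.sep Y := fun f => by
    simp only [T, Finset.mem_erase, Finset.mem_filter]
    exact and_congr_right fun _ => and_iff_right_of_imp fun h => hX.1 h.1
  let σ : SignedSet α := fun f => if f ∈ X.sep Y then 0 else X.comp Y f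
  have hσ_sep : ∀ f ∈ X.sep Y, σ f = 0 := fun f hf => if_pos hf
  have hσ_comp : ∀ f ∉ X.sep Y, σ f = X.comp Y f := fun f hf => if_neg hf
  suffices hσ : σ ∈ (M.contract T).vectors by
    obtain ⟨Z, hZ, hZσ⟩ := exists_vector_of_contract T hσ
    refine ⟨Z, hZ, ?_, fun f hf => ?_⟩
    · rw [hZσ e (by simp [hT]), hσ_sep e he]
    · rw [hZσ f (by simp [hT, hf]), hσ_comp f hf]
  refine mem_vectors_iff.2 ⟨fun f hf => Finset.mem_sdiff.2 ?_, fun D ⟨hD, hDT⟩ hn f => ?_⟩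
  · have hf' : f ∉ X.sep Y := fun h => hf (hσ_sep f h)
    refine ⟨(comp_mem_vectors hX hY).1 ?_, fun h => hf' ((hT f).1 h).2⟩
    rwa [mem_supp, ← hσ_comp f hf']
  · by_cases hf : f ∈ X.sep Y
    · rw [hσ_sep f hf, zero_mul]
    rw [hσ_comp f hf]
    exact (hX.2 D hD).mul_eq_zero_of_notMem_sep (hY.2 D hD) he
      (fun g hg hge => hDT g ((hT g).2 ⟨hge, hg⟩)) (fun g hg => hσ_comp g hg ▸ hn g) f hf

/-- The dual oriented matroid `M*`. -/
def dual (M : OrientedMatroid α) : OrientedMatroid α where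
  ground := M.ground
  covectors := M.vectors
  supp_subset _ hX := hX.1
  zero_mem := mem_vectors_iff.2 ⟨by simp [supp], by simp⟩
  neg_mem _ := neg_mem_vectors
  comp_mem _ hX _ hY := comp_mem_vectors hX hY
  elim _ hX _ hY _ := elim_vectors hX hY

theorem finite_covectors (M : OrientedMatroid α) : M.covectors.Finite := by
  classical
  refine (Set.finite_range fun (g : M.ground → SignType) (e : α) =>
    if h : e ∈ M.ground then g ⟨e, h⟩ else 0).subset fun X hX => ⟨fun e => X e, ?_⟩
  funext e
  by_cases h : e ∈ M.ground
  · simp [h]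
  · simp [h, apply_eq_zero_of_notMem (M.supp_subset X hX) h]

theorem exists_conforms_complementary {σ : SignedSet α} (hσ : σ.supp = M.ground) :
    ∃ Y ∈ M.covectors, Y.Conforms σ ∧ (fun f => if Y f = 0 then σ f else 0) ∈ M.vectors := by
  obtain ⟨Y, ⟨hY, hYσ⟩, hmax⟩ :=
    (M.finite_covectors.inter_of_left {Y | Y.Conforms σ}).exists_maximalFor
      supp _ ⟨0, M.zero_mem, fun _ => Or.inl rfl⟩
  refine ⟨Y, hY, hYσ, mem_vectors_iff.2
    ⟨fun f hf => hσ ▸ fun h => hf (by simp [h]), fun Z hZ hn f => ?_⟩⟩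
  have hYZ : (Y.comp Z).Conforms σ := fun g => by
    by_cases hg : Y g = 0
    · by_cases hσg : σ g = 0
      · have hg' : g ∉ M.ground := by rw [← Finset.mem_coe, ← hσ]; exact fun h => h hσg
        rw [comp_of_eq_zero hg]
        exact Or.inl (apply_eq_zero_of_notMem (M.supp_subset Z hZ) hg')
      · rw [comp_of_eq_zero hg]
        exact (mul_ne_neg_one_iff hσg).1 (by simpa only [hg, if_true] using hn g)
    · rw [comp_of_ne_zero hg]
      exact hYσ g
  split_ifs with hf
  · have hsub : Z.supp ⊆ Y.supp :=
      Set.subset_union_right.trans <| (supp_comp Y Z).symm.subset.trans <|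
        hmax ⟨M.comp_mem Y hY Z hZ, hYZ⟩ (supp_comp Y Z ▸ Set.subset_union_left)
    rw [not_not.1 fun h => hsub h hf, mul_zero]
  · rw [zero_mul]

theorem dual_dual (M : OrientedMatroid α) : M.dual.dual = M := by
  classical
  refine ext_covectors rfl (Set.Subset.antisymm (fun σ hσ => ?_) fun X hX =>
    ⟨M.supp_subset X hX, fun Y hY => orth_comm.1 (hY.2 X hX)⟩)
  let B := M.ground.filter (σ · = 0)
  have hB : σ.supp = (M.contract B).ground := Set.ext fun f => by
    simp only [contract, B, mem_supp, Finset.mem_coe, Finset.mem_sdiff, Finset.mem_filter]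
    exact ⟨fun h => ⟨hσ.1 h, fun h' => h h'.2⟩, fun h h' => h.2 ⟨h.1, h'⟩⟩
  obtain ⟨Y, hY, hYσ, hτ⟩ := exists_conforms_complementary hB
  obtain ⟨Z, hZ, hZτ⟩ := exists_vector_of_contract B hτ
  have hσZ : ∀ f, σ f * Z f = if Y f = 0 then σ f * σ f else 0 := fun f => by
    by_cases hf : σ f = 0
    · simp [hf]
    · rw [hZτ f (by simp [B, hf]), mul_ite, mul_zero]
  have hzero : ∀ f, σ f * Z f = 0 := (hσ.2 Z hZ).mul_eq_zero fun f => by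
    rw [hσZ]
    generalize σ f = x
    split_ifs <;> revert x <;> decide
  suffices hYσ' : Y = σ from hYσ' ▸ hY.1
  funext f
  refine (hYσ f).elim (fun hf => ?_) id
  have := hσZ f
  rw [hzero f, if_pos hf] at this
  rw [hf, mul_self_eq_zero.1 this.symm]

theorem dual_isCircuit {C : SignedSet α} : M.dual.IsCircuit C ↔ M.IsCocircuit C := by
  rw [IsCircuit, IsCocircuit, show M.dual.vectors = M.covectors from
    congrArg covectors M.dual_dual]

theorem dual_isPosCocircuit {D : SignedSet α} : M.dual.IsPosCocircuit D ↔ M.IsPosCircuit D :=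
  Iff.rfl

theorem exists_covector_of_mem_sep {W : SignedSet α} (hX : X ∈ M.covectors)
    (hW : W ∈ M.covectors) (hWX : W.supp ⊆ X.supp) {g : α} (hg : g ∈ X.sep W) :
    ∃ Z ∈ M.covectors, Z.supp ⊂ X.supp ∧ Z g = 0 ∧ ∀ f ∉ X.sep W, Z f = X f := by
  obtain ⟨Z, hZ, hZg, hZf⟩ := M.elim X hX W hW g hg
  have hZX : ∀ f ∉ X.sep W, Z f = X f := fun f hf => by
    rw [hZf f hf]
    by_cases hXf : X f = 0
    · rw [comp_of_eq_zero hXf, hXf, not_not.1 fun h => hWX h hXf]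
    · exact comp_of_ne_zero hXf
  refine ⟨Z, hZ, ⟨fun f hf => ?_, fun h => h hg.1 hZg⟩, hZg, hZX⟩
  by_cases hfs : f ∈ X.sep W
  · exact hfs.1
  · rwa [mem_supp, ← hZX f hfs]

theorem exists_covector_supp_ssubset {W : SignedSet α} (hX : X ∈ M.covectors) {e : α}
    (he : X e ≠ 0) (hW : W ∈ M.covectors) (hW0 : W ≠ 0) (hWX : W.supp ⊂ X.supp) :
    ∃ Z ∈ M.covectors, Z.supp ⊂ X.supp ∧ Z e = X e := by
  have exists_eq : ∀ f, W f ≠ 0 → ∃ V ∈ M.covectors, V.supp = W.supp ∧ V f = X f := fun f hf => by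
    rcases eq_or_eq_neg_of_ne_zero (hWX.1 hf) hf with h | h
    · exact ⟨W, hW, rfl, h⟩
    · exact ⟨-W, M.neg_mem W hW, supp_neg W, by simp [h]⟩
  by_cases hWe : W e = 0
  · obtain ⟨g, hg⟩ := Function.ne_iff.1 hW0
    obtain ⟨V, hV, hVs, hVg⟩ := exists_eq g hg
    have hVe : (-V) e = 0 := by
      by_contra h
      exact (hVs ▸ supp_neg V ▸ h : e ∈ W.supp) hWe
    obtain ⟨Z, hZ, hZs, -, hZX⟩ := exists_covector_of_mem_sep hX (M.neg_mem V hV)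
      (by rw [supp_neg, hVs]; exact hWX.1) (g := g) ⟨hWX.1 hg, by rw [Pi.neg_apply, hVg]⟩
    exact ⟨Z, hZ, hZs, hZX e fun h => he (by simpa [hVe] using h.2.symm)⟩
  · obtain ⟨V, hV, hVs, hVe⟩ := exists_eq e hWe
    exact ⟨V, hV, hVs ▸ hWX, hVe⟩

theorem exists_conforms_supp_ssubset {W : SignedSet α} (hX : X ∈ M.covectors) {e : α}
    (he : X e ≠ 0) (hW : W ∈ M.covectors) (hW0 : W ≠ 0) (hWX : W.supp ⊂ X.supp) :
    ∃ Z ∈ M.covectors, Z.Conforms X ∧ Z.supp ⊂ X.supp ∧ Z e = X e := by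
  obtain ⟨Z₀, hZ₀⟩ := exists_covector_supp_ssubset hX he hW hW0 hWX
  obtain ⟨Z, ⟨hZ, hZX, hZe⟩, hmin⟩ :=
    (M.finite_covectors.inter_of_left {Z | Z.supp ⊂ X.supp ∧ Z e = X e}).exists_minimalFor
      X.sep _ ⟨Z₀, hZ₀⟩
  refine ⟨Z, hZ, fun g => or_iff_not_imp_left.2 fun hZg => ?_, hZX, hZe⟩
  by_contra hne
  have hg : g ∈ X.sep Z :=
    ⟨hZX.1 hZg, (eq_or_eq_neg_of_ne_zero (hZX.1 hZg) hZg).resolve_left hne⟩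
  obtain ⟨Z', hZ', hZ'X, hZ'g, hZ'f⟩ := exists_covector_of_mem_sep hX hZ hZX.1 hg
  have ne_neg : ∀ f, X f ≠ 0 → X f ≠ -X f := fun f hf => by
    generalize X f = x at hf
    revert x; decide
  have hZ'e : Z' e = X e := hZ'f e fun h => ne_neg e he (hZe ▸ h.2)
  have hsep : X.sep Z' ⊆ X.sep Z := fun f ⟨hf, hf'⟩ => by
    by_contra h
    exact ne_neg f hf (hZ'f f h ▸ hf')
  exact hg.1 (by simpa [hZ'g] using (hmin ⟨hZ', hZ'X, hZ'e⟩ hsep hg).2.symm)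

theorem exists_isCocircuit_conforms (hX : X ∈ M.covectors) {e : α} (he : X e ≠ 0) :
    ∃ D, M.IsCocircuit D ∧ D.Conforms X ∧ D e = X e := by
  obtain ⟨D, ⟨hD, hDX, hDe⟩, hmin⟩ :=
    (M.finite_covectors.inter_of_left {D | D.Conforms X ∧ D e = X e}).exists_minimalFor
      supp _ ⟨X, hX, fun _ => Or.inr rfl, rfl⟩
  have hD0 : D e ≠ 0 := hDe ▸ he
  refine ⟨D, ⟨hD, fun h => hD0 (by rw [h]; rfl), fun W hW hW0 hWD => ?_⟩, hDX, hDe⟩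
  by_contra hne
  obtain ⟨Z, hZ, hZD, hZs, hZe⟩ :=
    exists_conforms_supp_ssubset hD hD0 hW hW0 (hWD.ssubset_of_ne hne)
  exact hZs.2 (hmin ⟨hZ, hZD.trans hDX, hZe.trans hDe⟩ hZs.1)

theorem exists_isCircuit_conforms (hX : X ∈ M.vectors) {e : α} (he : X e ≠ 0) :
    ∃ C, M.IsCircuit C ∧ C.Conforms X ∧ C e = X e :=
  exists_isCocircuit_conforms (M := M.dual) hX he

end Vectors

section PosSupport

variable {α : Type*} {M : OrientedMatroid α} {U V : Set α} {e p : α}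

/-- `U` is the support of a positive covector, equivalently a union of positive cocircuits. -/
def IsPosSupport (M : OrientedMatroid α) (U : Set α) : Prop :=
  ∃ X ∈ M.covectors, X.IsPositive ∧ X.supp = U

theorem isPosSupport_empty (M : OrientedMatroid α) : M.IsPosSupport ∅ :=
  ⟨0, M.zero_mem, fun _ he => absurd rfl he, supp_eq_empty_iff.2 rfl⟩

theorem IsPosCocircuit.isPosSupport {D : SignedSet α} (hD : M.IsPosCocircuit D) :
    M.IsPosSupport D.supp :=
  ⟨D, hD.1.1, hD.2, rfl⟩

theorem IsPosSupport.subset_ground (hU : M.IsPosSupport U) : U ⊆ M.ground := by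
  obtain ⟨X, hX, -, rfl⟩ := hU
  exact M.supp_subset X hX

theorem IsPosSupport.union (hU : M.IsPosSupport U) (hV : M.IsPosSupport V) :
    M.IsPosSupport (U ∪ V) := by
  obtain ⟨X, hX, hXpos, rfl⟩ := hU
  obtain ⟨Y, hY, hYpos, rfl⟩ := hV
  exact ⟨X.comp Y, M.comp_mem X hX Y hY, hXpos.comp hYpos, supp_comp X Y⟩

theorem IsPosSupport.exists_isPosCocircuit (hU : M.IsPosSupport U) (he : e ∈ U) :
    ∃ D, M.IsPosCocircuit D ∧ D.supp ⊆ U ∧ e ∈ D.supp := by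
  obtain ⟨X, hX, hXpos, rfl⟩ := hU
  obtain ⟨D, hD, hDX, hDe⟩ := exists_isCocircuit_conforms hX he
  exact ⟨D, ⟨hD, hDX.isPositive hXpos⟩, hDX.supp_subset, mem_supp.2 (hDe ▸ he)⟩

theorem isPosSupport_of_forall_exists (h : ∀ e ∈ U, ∃ V, M.IsPosSupport V ∧ V ⊆ U ∧ e ∈ V) :
    M.IsPosSupport U := by
  obtain ⟨X, ⟨hX, hXpos, hXU⟩, hmax⟩ :=
    (M.finite_covectors.inter_of_left {X | X.IsPositive ∧ X.supp ⊆ U}).exists_maximalFor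
      supp _ ⟨0, M.zero_mem, fun _ he => absurd rfl he, fun _ he => absurd rfl he⟩
  refine ⟨X, hX, hXpos, hXU.antisymm fun e he => ?_⟩
  obtain ⟨_, ⟨Y, hY, hYpos, rfl⟩, hYU, heY⟩ := h e he
  have hsupp := supp_comp X Y
  refine hmax ⟨M.comp_mem X hX Y hY, hXpos.comp hYpos, ?_⟩ ?_ (hsupp ▸ Or.inr heY)
  · exact hsupp ▸ Set.union_subset hXU hYU
  · exact hsupp ▸ Set.subset_union_left

theorem IsPosSupport.disjoint_dual (hU : M.IsPosSupport U) (hV : M.dual.IsPosSupport V) :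
    Disjoint U V := by
  obtain ⟨X, hX, hXpos, rfl⟩ := hU
  obtain ⟨Y, hY, hYpos, rfl⟩ := hV
  rw [isPositive_iff] at hXpos hYpos
  refine Set.disjoint_left.2 fun e heX heY => ?_
  have h := (hY.2 X hX).mul_eq_zero (fun f => ?_) e
  · exact (mul_eq_zero.1 h).elim heY heX
  · rcases hXpos f with h | h <;> rcases hYpos f with h' | h' <;> simp [h, h']

theorem exists_isPosSupport_sdiff (M : OrientedMatroid α) :
    ∃ U, M.IsPosSupport U ∧ M.dual.IsPosSupport (M.ground \ U) := by
  classical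
  let σ : SignedSet α := fun e => if e ∈ M.ground then 1 else 0
  have hσ : σ.supp = M.ground := Set.ext fun e => by simp [σ, supp]
  have hσpos : σ.IsPositive := fun e he => if_pos (hσ ▸ he : e ∈ (M.ground : Set α))
  obtain ⟨Y, hY, hYσ, hτ⟩ := exists_conforms_complementary hσ
  refine ⟨Y.supp, ⟨Y, hY, hYσ.isPositive hσpos, rfl⟩, _, hτ, fun e he => ?_, ?_⟩
  · have hYe : Y e = 0 := by
      by_contra h
      exact he (if_neg h)
    rw [mem_supp, if_pos hYe] at he
    simpa only [if_pos hYe] using hσpos e he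
  · rw [← hσ]
    ext e
    by_cases hYe : Y e = 0 <;> simp [mem_supp, hYe]

theorem isAcyclic_iff : M.IsAcyclic ↔ M.IsPosSupport M.ground := by
  refine ⟨fun h => ?_, fun h C hC => ?_⟩
  · obtain ⟨U, hU, hUc⟩ := M.exists_isPosSupport_sdiff
    suffices hsub : (M.ground : Set α) ⊆ U from hU.subset_ground.antisymm hsub ▸ hU
    intro e he
    by_contra heU
    obtain ⟨C, hC, -⟩ := hUc.exists_isPosCocircuit ⟨he, heU⟩
    exact h C hC
  · have hC' := (dual_isPosCocircuit.2 hC).isPosSupport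
    exact hC.1.2.1 <| supp_eq_empty_iff.1 <|
      disjoint_self.1 ((h.disjoint_dual hC').mono_left hC'.subset_ground)

theorem isTotallyCyclic_iff : M.IsTotallyCyclic ↔ M.dual.IsAcyclic := by
  rw [isAcyclic_iff]
  refine ⟨fun h => isPosSupport_of_forall_exists fun e he => ?_, fun h e he => ?_⟩
  · obtain ⟨C, hC, heC⟩ := h e he
    exact ⟨C.supp, (dual_isPosCocircuit.2 hC).isPosSupport, hC.1.1.1, heC⟩
  · obtain ⟨C, hC, -, heC⟩ := h.exists_isPosCocircuit he
    exact ⟨C, hC, heC⟩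

theorem isDualBoundedAt_iff : M.IsDualBoundedAt p ↔ M.dual.IsBoundedAt p :=
  and_congr_right' (and_congr_left' isTotallyCyclic_iff)

theorem isBoundedAt_iff : M.IsBoundedAt p ↔ p ∈ M.ground ∧ M.IsPosSupport M.ground ∧
    ∀ U, M.IsPosSupport U → U.Nonempty → p ∈ U := by
  refine and_congr_right' (and_congr isAcyclic_iff ⟨fun h U hU ⟨e, he⟩ => ?_, fun h D hD => ?_⟩)
  · obtain ⟨D, hD, hDU, -⟩ := hU.exists_isPosCocircuit he
    exact hDU (h D hD)
  · exact h _ hD.isPosSupport (Set.nonempty_iff_ne_empty.2 (mt supp_eq_empty_iff.1 hD.1.2.1))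

end PosSupport

section Minors

variable {α : Type*} [DecidableEq α] {M : OrientedMatroid α}

theorem restrict_congr {A B : Finset α} (h : M.ground ∩ A = M.ground ∩ B) :
    M.restrict A = M.restrict B := by
  refine ext_covectors h (Set.image_congr fun X hX => funext fun e => ?_)
  by_cases he : e ∈ M.ground
  · have hAB : e ∈ A ↔ e ∈ B := by simpa [he] using Finset.ext_iff.1 h e
    simp only [restr, hAB]
  · simp [restr, apply_eq_zero_of_notMem (M.supp_subset X hX) he]

theorem contract_restrict {A B : Finset α} (hBA : B ⊆ A) :
    (M.contract B).restrict A = M.minor A B := by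
  refine ext_covectors (Finset.sdiff_inter_right_comm ..) (Set.Subset.antisymm ?_ ?_)
  · rintro _ ⟨X, ⟨hX, hXB⟩, rfl⟩
    exact ⟨⟨X, hX, rfl⟩, fun e he => by simp [restr, hXB e he]⟩
  · rintro _ ⟨⟨X, hX, rfl⟩, hXB⟩
    exact ⟨X, ⟨hX, fun e he => by simpa [restr, hBA he] using hXB e he⟩, rfl⟩

theorem contract_dual (M : OrientedMatroid α) (F : Finset α) :
    (M.contract F).dual = M.dual.restrict (M.ground \ F) := by
  refine ext_covectors (Finset.inter_eq_right.2 Finset.sdiff_subset).symm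
    (Set.Subset.antisymm (fun X hX => ?_) ?_)
  · obtain ⟨Z, hZ, hZX⟩ := exists_vector_of_contract F hX
    refine ⟨Z, hZ, funext fun e => ?_⟩
    by_cases he : e ∈ M.ground \ F
    · rw [restr, if_pos he, hZX e (Finset.mem_sdiff.1 he).2]
    · rw [restr, if_neg he, apply_eq_zero_of_notMem hX.1 he]
  · rintro _ ⟨Z, hZ, rfl⟩
    refine ⟨fun e he => ?_, fun Y hY => (orth_congr fun e => ?_).2 (hZ.2 Y hY.1)⟩
    · by_contra h
      exact he (if_neg h)
    · by_cases he : e ∈ M.ground \ F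
      · rw [restr, if_pos he]
      · rw [apply_eq_zero_of_notMem ((M.contract F).supp_subset Y hY) he, mul_zero, mul_zero]

theorem restrict_dual (M : OrientedMatroid α) (G : Finset α) :
    (M.restrict G).dual = M.dual.contract (M.ground \ G) := by
  rw [← (M.dual.contract _).dual_dual, contract_dual, dual_dual]
  exact congrArg dual (restrict_congr (by simp [dual]))

theorem minor_dual {F G : Finset α} (hFG : F ⊆ G) :
    (M.minor G F).dual = M.dual.minor (M.ground \ F) (M.ground \ G) := by
  rw [minor, contract_dual, restrict_dual,
    ← contract_restrict (Finset.sdiff_subset_sdiff subset_rfl hFG)]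
  refine restrict_congr (Finset.ext fun e => ?_)
  simp only [contract, restrict, dual, Finset.mem_inter, Finset.mem_sdiff]
  tauto

variable {U V : Finset α}

theorem minor_sdiff_ground (hU : U ⊆ M.ground) :
    (M.minor (M.ground \ V) (M.ground \ U)).ground = U \ V := by
  ext e
  have := @hU e
  simp only [minor, contract, restrict, Finset.mem_inter, Finset.mem_sdiff]
  tauto

theorem isPosSupport_minor {W : Set α} (hU : U ⊆ M.ground) (hV : M.IsPosSupport V) :
    (M.minor (M.ground \ V) (M.ground \ U)).IsPosSupport W ↔
      W ⊆ U \ V ∧ M.IsPosSupport (W ∪ V) := by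
  constructor
  · intro hW
    refine ⟨by simpa [minor_sdiff_ground hU] using hW.subset_ground, ?_⟩
    obtain ⟨_, ⟨⟨X, hX, rfl⟩, -⟩, hXpos, rfl⟩ := hW
    obtain ⟨P, hP, hPpos, hPV⟩ := hV
    have hPX : P.comp X = P.comp (restr (M.ground \ V) X) := funext fun e => by
      by_cases heV : e ∈ V
      · have heP : P e ≠ 0 := (hPV.symm ▸ heV : e ∈ P.supp)
        rw [comp_of_ne_zero heP, comp_of_ne_zero heP]
      by_cases he : e ∈ M.ground
      · simp [comp, restr, he, heV]
      · simp [comp, restr, he, apply_eq_zero_of_notMem (M.supp_subset X hX) he]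
    refine ⟨P.comp X, M.comp_mem P hP X hX, hPX ▸ hPpos.comp hXpos, ?_⟩
    rw [hPX, supp_comp, hPV, Set.union_comm]
  · rintro ⟨hWUV, X, hX, hXpos, hXW⟩
    have hXW' : ∀ e, X e ≠ 0 ↔ e ∈ W ∨ e ∈ V := fun e => by
      rw [← mem_supp, hXW]; rfl
    refine ⟨restr (M.ground \ V) X, ⟨⟨X, hX, rfl⟩, fun e he => ?_⟩,
      isPositive_iff.2 fun e => ?_, Set.ext fun e => ?_⟩
    · rw [restr, ite_eq_right_iff]
      intro heV
      by_contra h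
      have heW := ((hXW' e).1 h).resolve_right (Finset.mem_sdiff.1 heV).2
      exact (Finset.mem_sdiff.1 he).2 (hWUV heW).1
    · rw [restr]
      split_ifs
      exacts [isPositive_iff.1 hXpos e, Or.inl rfl]
    · rw [mem_supp, restr, ite_ne_right_iff, Finset.mem_sdiff, hXW']
      exact ⟨fun h => h.2.resolve_right h.1.2,
        fun h => ⟨⟨hU (hWUV h).1, (hWUV h).2⟩, Or.inl h⟩⟩

theorem isBoundedAt_minor_iff {p : α} (hU : U ⊆ M.ground) (hVU : V ⊆ U) (hV : M.IsPosSupport V) :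
    (M.minor (M.ground \ V) (M.ground \ U)).IsBoundedAt p ↔ p ∈ U \ V ∧ M.IsPosSupport U ∧
      ∀ W : Set α, M.IsPosSupport W → (V : Set α) ⊂ W → W ⊆ U → p ∈ W := by
  rw [isBoundedAt_iff, minor_sdiff_ground hU, Finset.coe_sdiff]
  simp only [isPosSupport_minor hU hV]
  rw [Set.sdiff_union_of_subset (Finset.coe_subset.2 hVU), and_iff_right subset_rfl]
  refine and_congr_right fun hp => and_congr_right fun _ =>
    ⟨fun h W hW hVW hWU => ?_, fun h W hW hne => ?_⟩
  · have hunion : W \ V ∪ V = W := Set.sdiff_union_of_subset hVW.1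
    exact (h (W \ V) ⟨Set.sdiff_subset_sdiff_left hWU, hunion.symm ▸ hW⟩
      (Set.nonempty_of_not_subset hVW.2)).1
  · obtain ⟨e, he⟩ := hne
    refine (h (W ∪ V) hW.2 ⟨Set.subset_union_right, fun hsub => ?_⟩ ?_).resolve_right
      (Finset.mem_sdiff.1 hp).2
    · exact (hW.1 he).2 (hsub (Or.inl he))
    · exact Set.union_subset (hW.1.trans Set.sdiff_subset) hVU

end Minors

section Connectivity

variable {α : Type*} {M : OrientedMatroid α} {C D : SignedSet α} {e f g p : α}

theorem supp_finite_of_mem_vectors {X : SignedSet α} (hX : X ∈ M.vectors) : X.supp.Finite :=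
  M.ground.finite_toSet.subset hX.1

theorem IsCircuit.exists_elim (hC : M.IsCircuit C) (hD : D ∈ M.vectors) (heC : e ∈ C.supp)
    (heD : e ∉ D.supp) (hfC : f ∈ C.supp) (hfD : f ∈ D.supp) :
    ∃ K, M.IsCircuit K ∧ e ∈ K.supp ∧ f ∉ K.supp ∧ K.supp ⊆ C.supp ∪ D.supp ∧
      (K.supp ∩ (D.supp \ C.supp)).Nonempty := by
  obtain ⟨D', hD', hsupp, hf⟩ : ∃ D' ∈ M.vectors, D'.supp = D.supp ∧ D' f = -C f := by
    rcases eq_or_eq_neg_of_ne_zero hfC hfD with h | h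
    · exact ⟨-D, neg_mem_vectors hD, supp_neg D, by simp [h]⟩
    · exact ⟨D, hD, rfl, h⟩
  obtain ⟨Z, hZ, hZf, hZ'⟩ := elim_vectors hC.1 hD' ⟨hfC, hf⟩
  have hZs : Z.supp ⊆ C.supp ∪ D.supp := fun g hg => by
    by_cases hgs : g ∈ C.sep D'
    · exact Or.inl hgs.1
    · rw [mem_supp, hZ' g hgs] at hg
      exact hsupp ▸ (supp_comp C D').subset hg
  have hZe : Z e = C e := by
    rw [hZ' e fun h => ?_, comp_of_ne_zero heC]
    refine heD (hsupp ▸ mem_supp.2 ?_)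
    simpa [h.2, mem_supp] using heC
  obtain ⟨K, hK, hKZ, hKe⟩ := exists_isCircuit_conforms hZ (hZe.symm ▸ heC : Z e ≠ 0)
  have hfK : f ∉ K.supp := fun h => hKZ.supp_subset h hZf
  refine ⟨K, hK, mem_supp.2 ((hKe.trans hZe).symm ▸ heC), hfK, hKZ.supp_subset.trans hZs, ?_⟩
  by_contra hempty
  have hKC : K.supp ⊆ C.supp := fun g hg => by
    by_contra hgC
    exact hempty ⟨g, hg, (hZs (hKZ.supp_subset hg)).resolve_left hgC, hgC⟩
  exact hfK ((hC.2.2 K hK.1 hK.2.1 hKC).symm ▸ hfC)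

theorem IsCircuit.exists_mem_mem (hC : M.IsCircuit C) (hD : M.IsCircuit D) (heC : e ∈ C.supp)
    (hfD : f ∈ D.supp) (hgC : g ∈ C.supp) (hgD : g ∈ D.supp) :
    ∃ K, M.IsCircuit K ∧ e ∈ K.supp ∧ f ∈ K.supp := by
  induction hn : (C.supp ∪ D.supp).ncard using Nat.strong_induction_on generalizing C D g with
  | _ n ih =>
  by_cases heD : e ∈ D.supp
  · exact ⟨D, hD, heD, hfD⟩
  by_cases hfC : f ∈ C.supp
  · exact ⟨C, hC, heC, hfC⟩
  have hfin := (supp_finite_of_mem_vectors hC.1).union (supp_finite_of_mem_vectors hD.1)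
  obtain ⟨K, hK, heK, hgK, hKCD, x, hxK, hxD, hxC⟩ := hC.exists_elim hD.1 heC heD hgC hgD
  obtain ⟨L, hL, hfL, hgL, hLDC, y, hyL, hyC, -⟩ := hD.exists_elim hC.1 hfD hfC hgD hgC
  have hLCD : L.supp ⊆ C.supp ∪ D.supp := by rwa [Set.union_comm]
  by_cases hxL : x ∈ L.supp
  · refine ih _ ?_ hK hL heK hfL hxK hxL rfl
    rw [← hn]
    exact Set.ncard_lt_ncard
      ⟨Set.union_subset hKCD hLCD, fun h => (h (Or.inl hgC)).elim hgK hgL⟩ hfin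
  · refine ih _ ?_ hC hL heC hfL hyC hyL rfl
    rw [← hn]
    exact Set.ncard_lt_ncard ⟨Set.union_subset Set.subset_union_left hLCD,
      fun h => (h (Or.inr hxD)).elim hxC hxL⟩ hfin

/-- The relation whose classes are the connected components: `e` and `f` are equal or lie in a
common circuit. -/
def Linked (M : OrientedMatroid α) (e f : α) : Prop :=
  e = f ∨ ∃ C, M.IsCircuit C ∧ e ∈ C.supp ∧ f ∈ C.supp

theorem Linked.symm (h : M.Linked e f) : M.Linked f e :=
  h.imp Eq.symm fun ⟨C, hC, he, hf⟩ => ⟨C, hC, hf, he⟩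

theorem Linked.trans (hef : M.Linked e f) (hfg : M.Linked f g) : M.Linked e g := by
  rcases hef with rfl | ⟨C, hC, heC, hfC⟩
  · exact hfg
  rcases hfg with rfl | ⟨D, hD, hfD, hgD⟩
  · exact Or.inr ⟨C, hC, heC, hfC⟩
  · exact Or.inr (hC.exists_mem_mem hD heC hgD hfC hfD)

theorem isConnected_of_forall_linked (h : ∀ e ∈ M.ground, M.Linked p e) : M.IsConnected :=
  fun e he f hf hef => ((h e he).symm.trans (h f hf)).resolve_left hef

theorem indicator_mem_covectors {X : SignedSet α} (hX : X ∈ M.covectors) {T : Set α}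
    (hT : ∀ e f, M.Linked e f → e ∈ T → f ∈ T) : T.indicator X ∈ M.covectors := by
  rw [← M.dual_dual]
  refine mem_vectors_iff.2 ⟨fun e he => M.supp_subset X hX fun h => he (by simp [h]),
    fun V hV hn e => ?_⟩
  by_contra hne
  have heT : e ∈ T := by
    by_contra h
    simp [h] at hne
  obtain ⟨C, hC, hCV, hCe⟩ := exists_isCircuit_conforms (M := M) hV (right_ne_zero_of_mul hne)
  have hCT : ∀ f, C f ≠ 0 → X f * C f = T.indicator X f * V f := fun f hf => by
    have hfT : f ∈ T :=
      hT e f (Or.inr ⟨C, hC, mem_supp.2 (hCe ▸ right_ne_zero_of_mul hne), hf⟩) heT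
    rw [Set.indicator_of_mem hfT, (hCV f).resolve_left hf]
  have hzero := (orth_comm.1 (hC.1.2 X hX)).mul_eq_zero (fun f => ?_) e
  · rw [hCT e (hCe ▸ right_ne_zero_of_mul hne)] at hzero
    exact hne hzero
  · by_cases hf : C f = 0
    · simp [hf]
    · exact hCT f hf ▸ hn f

theorem IsPosSupport.inter_of_forall_linked {U T : Set α} (hU : M.IsPosSupport U)
    (hT : ∀ e f, M.Linked e f → e ∈ T → f ∈ T) : M.IsPosSupport (U ∩ T) := by
  classical
  obtain ⟨X, hX, hXpos, rfl⟩ := hU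
  refine ⟨_, indicator_mem_covectors hX hT, isPositive_iff.2 fun f => ?_, Set.ext fun f => ?_⟩
  · by_cases hf : f ∈ T <;> simp [hf, isPositive_iff.1 hXpos f]
  · simp [mem_supp, and_comm]

theorem IsBoundedAt.isConnected (h : M.IsBoundedAt p) : M.IsConnected := by
  obtain ⟨-, hground, hmem⟩ := isBoundedAt_iff.1 h
  refine isConnected_of_forall_linked (p := p) fun e he => ?_
  by_contra hpe
  have hU := hground.inter_of_forall_linked (T := {f | ¬ M.Linked p f})
    fun _ _ hfg hpf hpg => hpf (hpg.trans hfg.symm)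
  exact (hmem _ hU ⟨e, he, hpe⟩).2 (Or.inl rfl)

theorem IsDualBoundedAt.isConnected (h : M.IsDualBoundedAt p) : M.IsConnected :=
  isConnected_of_forall_linked fun e he => by
    obtain ⟨C, hC, heC⟩ := h.2.1 e he
    exact Or.inr ⟨C, hC.1, h.2.2 C hC, heC⟩

theorem IsAcyclic.not_isLoop (h : M.IsAcyclic) : ¬ M.IsLoop := by
  rintro ⟨e, hground, C, hC, hCs⟩
  obtain ⟨X, hX, -, hXs⟩ := isAcyclic_iff.1 h
  have heX : e ∈ X.supp := by simp [hXs, hground]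
  have heC : e ∈ C.supp := by simp [hCs]
  obtain ⟨f, hfe, hfC, -⟩ := (hC.1.2 X hX).exists_ne heC heX
  exact hfe (hCs.subset hfC)

theorem IsTotallyCyclic.not_isIsthmus (h : M.IsTotallyCyclic) : ¬ M.IsIsthmus :=
  fun ⟨e, he, D, hD, hDs⟩ =>
    (isTotallyCyclic_iff.1 h).not_isLoop ⟨e, he, D, dual_isCircuit.2 hD, hDs⟩

end Connectivity

section Chains

variable {α : Type*} [LinearOrder α] {M : OrientedMatroid α} {U : Set α} {a : α}

theorem mem_dualActive : a ∈ M.dualActive ↔ ∃ U, M.IsPosSupport U ∧ IsLeast U a := by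
  simp only [dualActive, Finset.mem_filter]
  constructor
  · rintro ⟨-, D, hD, hDa⟩
    exact ⟨D.supp, hD.isPosSupport, hDa⟩
  · rintro ⟨U, hU, haU, hUa⟩
    obtain ⟨D, hD, hDU, haD⟩ := hU.exists_isPosCocircuit haU
    exact ⟨hU.subset_ground haU, D, hD, haD, fun _ he => hUa (hDU he)⟩

theorem mem_cocircuitUnion {e : α} :
    e ∈ M.cocircuitUnion a ↔ ∃ U, M.IsPosSupport U ∧ U ⊆ Set.Ici a ∧ e ∈ U := by
  simp only [cocircuitUnion, Finset.mem_filter]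
  constructor
  · rintro ⟨-, D, hD, hDa, heD⟩
    exact ⟨D.supp, hD.isPosSupport, hDa, heD⟩
  · rintro ⟨U, hU, hUa, heU⟩
    obtain ⟨D, hD, hDU, heD⟩ := hU.exists_isPosCocircuit heU
    exact ⟨hU.subset_ground heU, D, hD, fun _ hf => hUa (hDU hf), heD⟩

theorem isGreatest_cocircuitUnion (M : OrientedMatroid α) (a : α) :
    IsGreatest {U | M.IsPosSupport U ∧ U ⊆ Set.Ici a} (M.cocircuitUnion a) := by
  have hsub : ∀ U, M.IsPosSupport U → U ⊆ Set.Ici a → U ⊆ M.cocircuitUnion a :=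
    fun U hU hUa e he => mem_cocircuitUnion.2 ⟨U, hU, hUa, he⟩
  refine ⟨⟨isPosSupport_of_forall_exists fun e he => ?_, fun e he => ?_⟩,
    fun U hU => hsub U hU.1 hU.2⟩
  · obtain ⟨U, hU, hUa, heU⟩ := mem_cocircuitUnion.1 he
    exact ⟨U, hU, hsub U hU hUa, heU⟩
  · obtain ⟨U, -, hUa, heU⟩ := mem_cocircuitUnion.1 he
    exact hUa heU

/-- The complements `E \ F_0 ⊃ E \ F_1 ⊃ … ⊃ E \ F_ι = ∅` of the sets `F_k` of the active
filtration of `M`; for the dual of `M` these are the sets `F'_k`. -/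
noncomputable def activeCut (M : OrientedMatroid α) (k : Fin (M.dualActive.card + 1)) :
    Finset α :=
  if h : (k : ℕ) < M.dualActive.card then
    M.cocircuitUnion (M.dualActive.orderEmbOfFin rfl ⟨k, h⟩)
  else ∅

theorem activeCut_castSucc (k : Fin M.dualActive.card) :
    M.activeCut k.castSucc = M.cocircuitUnion (M.dualActive.orderEmbOfFin rfl k) :=
  dif_pos k.isLt

theorem activeCut_last (M : OrientedMatroid α) : M.activeCut (Fin.last _) = ∅ :=
  dif_neg (lt_irrefl _)

theorem isGreatest_activeCut (k : Fin (M.dualActive.card + 1)) :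
    IsGreatest {U | M.IsPosSupport U ∧ ∀ j : Fin M.dualActive.card, j.castSucc < k →
      U ⊆ Set.Ioi (M.dualActive.orderEmbOfFin rfl j)} (M.activeCut k) := by
  constructor
  · cases k using Fin.lastCases with
    | last => simp [activeCut_last, isPosSupport_empty]
    | cast k =>
      rw [activeCut_castSucc]
      obtain ⟨hpos, hle⟩ := (M.isGreatest_cocircuitUnion (M.dualActive.orderEmbOfFin rfl k)).1
      exact ⟨hpos, fun j hj e he => ((M.dualActive.orderEmbOfFin rfl).strictMono
        (Fin.castSucc_lt_castSucc_iff.1 hj)).trans_le (hle he)⟩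
  · rintro U ⟨hU, hlt⟩
    rcases U.eq_empty_or_nonempty with rfl | hne
    · exact Set.empty_subset _
    obtain ⟨b, hbU, hb⟩ :=
      Set.exists_min_image U id (M.ground.finite_toSet.subset hU.subset_ground) hne
    obtain ⟨j, rfl⟩ : b ∈ Set.range (M.dualActive.orderEmbOfFin rfl) := by
      rw [Finset.range_orderEmbOfFin]
      exact mem_dualActive.2 ⟨U, hU, hbU, hb⟩
    have hkj : k ≤ j.castSucc := le_of_not_gt fun hjk => lt_irrefl _ (hlt j hjk hbU)
    cases k using Fin.lastCases with
    | last => exact absurd (Fin.castSucc_lt_last j) hkj.not_gt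
    | cast k =>
      rw [activeCut_castSucc]
      refine (M.isGreatest_cocircuitUnion _).2 ⟨hU, fun e he => ?_⟩
      exact ((M.dualActive.orderEmbOfFin rfl).monotone
        (Fin.castSucc_le_castSucc_iff.1 hkj)).trans (hb e he)

theorem isLeast_activeCut (k : Fin M.dualActive.card) :
    IsLeast (M.activeCut k.castSucc : Set α) (M.dualActive.orderEmbOfFin rfl k) := by
  rw [activeCut_castSucc]
  have hgreatest := M.isGreatest_cocircuitUnion (M.dualActive.orderEmbOfFin rfl k)
  obtain ⟨U, hU, hkU, hUk⟩ := mem_dualActive.1 (M.dualActive.orderEmbOfFin_mem rfl k)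
  exact ⟨hgreatest.2 ⟨hU, hUk⟩ hkU, hgreatest.1.2⟩

/-- `E \ U_0 ⊂ E \ U_1 ⊂ … ⊂ E \ U_n = E` satisfies the conditions imposed on the sets `F_k` of a
filtration, and the minors it induces are bounded. Both halves of a filtration take this form, the
sets `F'_k` being such a chain for the dual. -/
structure IsBoundedChain (M : OrientedMatroid α) {n : ℕ} (U : Fin (n + 1) → Finset α) : Prop where
  subset_ground : U 0 ⊆ M.ground
  strictAnti : StrictAnti U
  last : U (Fin.last n) = ∅
  min_strictMono : StrictMono fun k : Fin n => (U k.castSucc \ U k.succ).min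
  isBoundedAt : ∀ k : Fin n, ∃ p : α, (U k.castSucc \ U k.succ).min = p ∧
    (M.minor (M.ground \ U k.succ) (M.ground \ U k.castSucc)).IsBoundedAt p

theorem isBoundedChain_activeCut (M : OrientedMatroid α) : M.IsBoundedChain M.activeCut := by
  have hanti : ∀ k : Fin M.dualActive.card, M.activeCut k.succ ⊆ M.activeCut k.castSucc :=
    fun k => (isGreatest_activeCut k.castSucc).2 ⟨(isGreatest_activeCut k.succ).1.1,
      fun j hj => (isGreatest_activeCut k.succ).1.2 j (hj.trans k.castSucc_lt_succ)⟩
  have hnotMem : ∀ k, M.dualActive.orderEmbOfFin rfl k ∉ M.activeCut k.succ := fun k hk =>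
    lt_irrefl _ ((isGreatest_activeCut k.succ).1.2 k k.castSucc_lt_succ hk)
  have hground : ∀ k, M.activeCut k ⊆ M.ground := fun k =>
    (isGreatest_activeCut k).1.1.subset_ground
  have hmem : ∀ k, M.dualActive.orderEmbOfFin rfl k ∈
      M.activeCut k.castSucc \ M.activeCut k.succ := fun k =>
    Finset.mem_sdiff.2 ⟨(isLeast_activeCut k).1, hnotMem k⟩
  have hmin : ∀ k, (M.activeCut k.castSucc \ M.activeCut k.succ).min =
      M.dualActive.orderEmbOfFin rfl k := fun k =>
    (Finset.min_le (hmem k)).antisymm <| Finset.le_min fun e he =>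
      WithTop.coe_le_coe.2 ((isLeast_activeCut k).2 (Finset.mem_sdiff.1 he).1)
  refine ⟨hground 0, Fin.strictAnti_iff_succ_lt.2 fun k => ?_, M.activeCut_last, ?_, fun k => ?_⟩
  · exact ⟨hanti k, fun h => hnotMem k (h (isLeast_activeCut k).1)⟩
  · simp only [hmin]
    exact fun j k hjk => WithTop.coe_lt_coe.2 ((M.dualActive.orderEmbOfFin rfl).strictMono hjk)
  · refine ⟨_, hmin k, (isBoundedAt_minor_iff (hground _) (hanti k)
      (isGreatest_activeCut k.succ).1.1).2 ⟨hmem k, (isGreatest_activeCut k.castSucc).1.1,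
        fun W hW hlt hWk => ?_⟩⟩
    by_contra hkW
    refine hlt.2 ((isGreatest_activeCut k.succ).2 ⟨hW, fun j hj e he => ?_⟩)
    have hke : M.dualActive.orderEmbOfFin rfl k ≤ e := (isLeast_activeCut k).2 (hWk he)
    refine lt_of_le_of_lt ((M.dualActive.orderEmbOfFin rfl).monotone ?_)
      (hke.lt_of_ne fun h => hkW (h ▸ he))
    exact Fin.castSucc_lt_succ_iff.1 hj

namespace IsBoundedChain

variable {n : ℕ} {U : Fin (n + 1) → Finset α} {p : Fin n → α}

theorem isPosSupport (h : M.IsBoundedChain U) (k : Fin (n + 1)) : M.IsPosSupport (U k) := by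
  induction k using Fin.reverseInduction with
  | last => simpa [h.last] using M.isPosSupport_empty
  | cast k ih =>
    obtain ⟨p, -, hp⟩ := h.isBoundedAt k
    have hsub : U k.castSucc ⊆ M.ground :=
      (h.strictAnti.antitone (Fin.zero_le _)).trans h.subset_ground
    exact ((isBoundedAt_minor_iff hsub (h.strictAnti k.castSucc_lt_succ).le ih).1 hp).2.1

theorem isLeast (h : M.IsBoundedChain U) (hp : ∀ k : Fin n, (U k.castSucc \ U k.succ).min = p k)
    (k : Fin n) : IsLeast (U k.castSucc : Set α) (p k) := by
  have exists_part : ∀ i : Fin (n + 1), ∀ e ∈ U i,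
      ∃ j : Fin n, i ≤ j.castSucc ∧ e ∈ U j.castSucc \ U j.succ := fun i e => by
    induction i using Fin.reverseInduction with
    | last => simp [h.last]
    | cast i ih =>
      intro he
      by_cases he' : e ∈ U i.succ
      · obtain ⟨j, hij, hj⟩ := ih he'
        exact ⟨j, i.castSucc_lt_succ.le.trans hij, hj⟩
      · exact ⟨i, le_rfl, Finset.mem_sdiff.2 ⟨he, he'⟩⟩
  refine ⟨(Finset.mem_sdiff.1 (Finset.mem_of_min (hp k))).1, fun e he => ?_⟩
  obtain ⟨j, hkj, hj⟩ := exists_part _ e he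
  refine le_trans ?_ (Finset.min_le_of_eq hj (hp j))
  rw [← WithTop.coe_le_coe, ← hp, ← hp]
  exact h.min_strictMono.monotone (Fin.castSucc_le_castSucc_iff.1 hkj)

theorem exists_mem_of_isPosSupport (h : M.IsBoundedChain U)
    (hp : ∀ k : Fin n, (U k.castSucc \ U k.succ).min = p k) {W : Set α} (hW : M.IsPosSupport W)
    (hne : W.Nonempty) (hW0 : W ⊆ U 0) : ∃ j : Fin n, W ⊆ U j.castSucc ∧ p j ∈ W := by
  obtain ⟨j, hj, hj'⟩ : ∃ j : Fin n, W ⊆ U j.castSucc ∧ ¬ W ⊆ U j.succ := by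
    by_contra! hcon
    have hlast : W ⊆ U (Fin.last n) :=
      Fin.induction (motive := fun i => W ⊆ U i) hW0 hcon (Fin.last n)
    simp [h.last, hne.ne_empty] at hlast
  refine ⟨j, hj, ?_⟩
  have hsub : U j.castSucc ⊆ M.ground :=
    (h.strictAnti.antitone (Fin.zero_le _)).trans h.subset_ground
  have hanti : U j.succ ⊆ U j.castSucc := (h.strictAnti j.castSucc_lt_succ).le
  obtain ⟨q, hq, hbdd⟩ := h.isBoundedAt j
  obtain rfl : p j = q := WithTop.coe_injective ((hp j).symm.trans hq)
  obtain ⟨hpj, -, hmem⟩ := (isBoundedAt_minor_iff hsub hanti (h.isPosSupport j.succ)).1 hbdd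
  have hpos : M.IsPosSupport (W ∪ U j.succ) := hW.union (h.isPosSupport _)
  have hlt : (U j.succ : Set α) ⊂ W ∪ U j.succ :=
    ⟨Set.subset_union_right, fun hsub => hj' (Set.subset_union_left.trans hsub)⟩
  exact (hmem _ hpos hlt (Set.union_subset hj hanti)).resolve_right (Finset.mem_sdiff.1 hpj).2

theorem cocircuitUnion_eq (h : M.IsBoundedChain U)
    (hp : ∀ k : Fin n, (U k.castSucc \ U k.succ).min = p k)
    (h0 : ∀ W, M.IsPosSupport W → W ⊆ U 0) (k : Fin n) :
    M.cocircuitUnion (p k) = U k.castSucc := by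
  refine Finset.coe_injective ((M.isGreatest_cocircuitUnion (p k)).unique
    ⟨⟨h.isPosSupport _, (h.isLeast hp k).2⟩, fun W ⟨hW, hWk⟩ => ?_⟩)
  rcases W.eq_empty_or_nonempty with rfl | hne
  · exact Set.empty_subset _
  obtain ⟨j, hWj, hjW⟩ := h.exists_mem_of_isPosSupport hp hW hne (h0 W hW)
  have hkj : k ≤ j := h.min_strictMono.le_iff_le.1 <| by
    rw [hp, hp]
    exact WithTop.coe_le_coe.2 (hWk hjW)
  exact hWj.trans (h.strictAnti.antitone (Fin.castSucc_le_castSucc_iff.2 hkj))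

theorem mem_dualActive_iff (h : M.IsBoundedChain U)
    (hp : ∀ k : Fin n, (U k.castSucc \ U k.succ).min = p k)
    (h0 : ∀ W, M.IsPosSupport W → W ⊆ U 0) : a ∈ M.dualActive ↔ ∃ k, p k = a := by
  rw [mem_dualActive]
  constructor
  · rintro ⟨W, hW, haW, hWa⟩
    obtain ⟨j, hWj, hjW⟩ := h.exists_mem_of_isPosSupport hp hW ⟨a, haW⟩ (h0 W hW)
    exact ⟨j, ((h.isLeast hp j).2 (hWj haW)).antisymm (hWa hjW)⟩
  · rintro ⟨k, rfl⟩
    exact ⟨_, h.isPosSupport k.castSucc, h.isLeast hp k⟩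

theorem eq_activeCut (h : M.IsBoundedChain U) (h0 : ∀ W, M.IsPosSupport W → W ⊆ U 0) :
    ∃ hn : n = M.dualActive.card, ∀ k, U k = M.activeCut (Fin.cast (congrArg (· + 1) hn) k) := by
  choose p hp _ using h.isBoundedAt
  have hmono : StrictMono p := fun j k hjk => by
    rw [← WithTop.coe_lt_coe, ← hp, ← hp]
    exact h.min_strictMono hjk
  have himage : Finset.univ.image p = M.dualActive := Finset.ext fun a => by
    simp [h.mem_dualActive_iff hp h0]
  obtain rfl : n = M.dualActive.card := by
    rw [← himage, Finset.card_image_of_injective _ hmono.injective, Finset.card_fin]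
  have hemb : p = M.dualActive.orderEmbOfFin rfl := Finset.orderEmbOfFin_unique rfl
    (fun k => (h.mem_dualActive_iff hp h0).2 ⟨k, rfl⟩) hmono
  refine ⟨rfl, fun k => ?_⟩
  cases k using Fin.lastCases with
  | last => exact h.last.trans M.activeCut_last.symm
  | cast k => exact (h.cocircuitUnion_eq hp h0 k).symm.trans (hemb ▸ (activeCut_castSucc k).symm)

end IsBoundedChain

end Chains

section Filtrations

variable {α : Type*} [LinearOrder α] {M : OrientedMatroid α} {n : ℕ} {F : Fin (n + 1) → Finset α}
  {S : SetSeq α}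

theorem isBoundedChain_sdiff_iff (hF : ∀ k, F k ⊆ M.ground) :
    M.IsBoundedChain (fun k => M.ground \ F k) ↔
      StrictMono F ∧ F (Fin.last n) = M.ground ∧
      (StrictMono fun k : Fin n => (F k.succ \ F k.castSucc).min) ∧
      ∀ k : Fin n, ∃ p : α, (F k.succ \ F k.castSucc).min = p ∧
        (M.minor (F k.succ) (F k.castSucc)).IsBoundedAt p := by
  have hanti : StrictAnti (fun k => M.ground \ F k) ↔ StrictMono F := by
    simp only [StrictAnti, StrictMono, lt_iff_le_not_ge, sdiff_le_sdiff_iff_le (hF _) (hF _)]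
  have hlast : M.ground \ F (Fin.last n) = ∅ ↔ F (Fin.last n) = M.ground := by
    rw [Finset.sdiff_eq_empty_iff_subset]
    exact ⟨(hF _).antisymm, fun h => h.ge⟩
  have hpart : ∀ k : Fin n, (M.ground \ F k.castSucc) \ (M.ground \ F k.succ) =
      F k.succ \ F k.castSucc := fun k => by
    ext e
    have := @hF k.succ e
    simp only [Finset.mem_sdiff]
    tauto
  have hminor : ∀ k : Fin n, M.minor (M.ground \ (M.ground \ F k.succ))
      (M.ground \ (M.ground \ F k.castSucc)) = M.minor (F k.succ) (F k.castSucc) := fun k => by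
    rw [Finset.sdiff_sdiff_eq_self (hF _), Finset.sdiff_sdiff_eq_self (hF _)]
  constructor
  · rintro ⟨-, hchain, htop, hmin, hbdd⟩
    simp only [hpart, hminor] at hmin hbdd
    exact ⟨hanti.1 hchain, hlast.1 htop, hmin, hbdd⟩
  · rintro ⟨hchain, htop, hmin, hbdd⟩
    refine ⟨Finset.sdiff_subset, hanti.2 hchain, hlast.2 htop, ?_, ?_⟩
    · simpa only [hpart] using hmin
    · simpa only [hpart, hminor] using hbdd

theorem isBoundedChain_dual_iff : M.dual.IsBoundedChain F ↔
    F 0 ⊆ M.ground ∧ StrictAnti F ∧ F (Fin.last n) = ∅ ∧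
    (StrictMono fun k : Fin n => (F k.castSucc \ F k.succ).min) ∧
    ∀ k : Fin n, ∃ p : α, (F k.castSucc \ F k.succ).min = p ∧
      (M.minor (F k.castSucc) (F k.succ)).IsDualBoundedAt p := by
  have hminor : StrictAnti F → ∀ (k : Fin n) (p : α),
      (M.minor (F k.castSucc) (F k.succ)).IsDualBoundedAt p ↔
        (M.dual.minor (M.dual.ground \ F k.succ) (M.dual.ground \ F k.castSucc)).IsBoundedAt p :=
    fun hF k p => by
      rw [isDualBoundedAt_iff, minor_dual (hF k.castSucc_lt_succ).le]
      rfl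
  constructor
  · rintro ⟨hground, hanti, hlast, hmin, hbdd⟩
    simp only [← hminor hanti] at hbdd
    exact ⟨hground, hanti, hlast, hmin, hbdd⟩
  · rintro ⟨hground, hanti, hlast, hmin, hbdd⟩
    simp only [hminor hanti] at hbdd
    exact ⟨hground, hanti, hlast, hmin, hbdd⟩

theorem isFiltration_and_hasBoundedMinors_iff :
    M.IsFiltration S ∧ M.HasBoundedMinors S ↔ (∀ k, S.F k ⊆ M.ground) ∧
      S.F' 0 = S.Fc ∧ S.F 0 = S.Fc ∧
      M.IsBoundedChain (fun k => M.ground \ S.F k) ∧ M.dual.IsBoundedChain S.F' := by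
  constructor
  · rintro ⟨hS, hb⟩
    have hF : ∀ k, S.F k ⊆ M.ground := fun k =>
      hS.F_last ▸ hS.F_strictMono.monotone (Fin.le_last k)
    have hF' : S.F' 0 ⊆ M.ground := (hS.F'_zero.trans hS.F_zero.symm) ▸ hF 0
    exact ⟨hF, hS.F'_zero, hS.F_zero,
      (isBoundedChain_sdiff_iff hF).2 ⟨hS.F_strictMono, hS.F_last, hS.min_part, hb.1⟩,
      isBoundedChain_dual_iff.2 ⟨hF', hS.F'_strictAnti, hS.F'_last, hS.min_part', hb.2⟩⟩
  · rintro ⟨hF, hF'_zero, hF_zero, hchain, hchain'⟩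
    obtain ⟨hmono, hlast, hmin, hbdd⟩ := (isBoundedChain_sdiff_iff hF).1 hchain
    obtain ⟨-, hanti', hlast', hmin', hbdd'⟩ := isBoundedChain_dual_iff.1 hchain'
    exact ⟨⟨hlast', hanti', hF'_zero, hF_zero, hmono, hlast, hmin, hmin'⟩, hbdd, hbdd'⟩

theorem IsPosSupport.subset_activeCut_zero {U : Set α} (hU : M.IsPosSupport U) :
    U ⊆ M.activeCut 0 :=
  (isGreatest_activeCut 0).2 ⟨hU, fun _ hj => absurd hj (Fin.not_lt_zero _)⟩

theorem isPosSupport_activeCut_zero (M : OrientedMatroid α) : M.IsPosSupport (M.activeCut 0) :=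
  (isGreatest_activeCut 0).1.1

theorem dual_activeCut_zero (M : OrientedMatroid α) : M.dual.activeCut 0 = M.cyclicPart := by
  ext e
  simp only [cyclicPart, Finset.mem_filter]
  constructor
  · intro he
    obtain ⟨C, hC, -, heC⟩ := M.dual.isPosSupport_activeCut_zero.exists_isPosCocircuit he
    exact ⟨M.dual.isPosSupport_activeCut_zero.subset_ground he, C, hC, heC⟩
  · rintro ⟨-, C, hC, heC⟩
    exact (dual_isPosCocircuit.2 hC).isPosSupport.subset_activeCut_zero heC

theorem sdiff_activeCut_zero (M : OrientedMatroid α) :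
    M.ground \ M.activeCut 0 = M.cyclicPart := by
  rw [← dual_activeCut_zero]
  obtain ⟨U, hU, hUc⟩ := M.exists_isPosSupport_sdiff
  refine Finset.Subset.antisymm (fun e he => ?_) fun e he => Finset.mem_sdiff.2 ⟨?_, fun he' => ?_⟩
  · obtain ⟨heM, heU⟩ := Finset.mem_sdiff.1 he
    exact hUc.subset_activeCut_zero ⟨heM, fun h => heU (hU.subset_activeCut_zero h)⟩
  · exact M.dual.isPosSupport_activeCut_zero.subset_ground he
  · exact Set.disjoint_left.1
      (M.isPosSupport_activeCut_zero.disjoint_dual M.dual.isPosSupport_activeCut_zero) he' he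

theorem activeFiltration_F (k : Fin (M.dualActive.card + 1)) :
    M.activeFiltration.F k = M.ground \ M.activeCut k := by
  simp only [activeFiltration, activeCut]
  split_ifs
  exacts [rfl, Finset.sdiff_empty.symm]

theorem isFiltration_activeFiltration_and_hasBoundedMinors (M : OrientedMatroid α) :
    M.IsFiltration M.activeFiltration ∧ M.HasBoundedMinors M.activeFiltration := by
  refine isFiltration_and_hasBoundedMinors_iff.2 ⟨fun k => ?_, M.dual_activeCut_zero,
    (activeFiltration_F 0).trans M.sdiff_activeCut_zero, ?_, M.dual.isBoundedChain_activeCut⟩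
  · exact activeFiltration_F k ▸ Finset.sdiff_subset
  · have hcut : M.activeCut = fun k => M.ground \ M.activeFiltration.F k := funext fun k => by
      rw [activeFiltration_F,
        Finset.sdiff_sdiff_eq_self (isGreatest_activeCut k).1.1.subset_ground]
    exact hcut ▸ M.isBoundedChain_activeCut

theorem HasBoundedMinors.eq_activeFiltration (hb : M.HasBoundedMinors S) (hS : M.IsFiltration S) :
    S = M.activeFiltration := by
  obtain ⟨hF, hF'_zero, hF_zero, hchain, hchain'⟩ :=
    isFiltration_and_hasBoundedMinors_iff.1 ⟨hS, hb⟩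
  have hFc : M.dual.IsPosSupport S.Fc := hF'_zero ▸ hchain'.isPosSupport 0
  have hFc' : M.IsPosSupport (M.ground \ S.Fc) := by
    simpa [hF_zero] using hchain.isPosSupport 0
  obtain ⟨hι, hFk⟩ := hchain.eq_activeCut fun W hW => by
    simpa [hF_zero, Set.subset_sdiff] using ⟨hW.subset_ground, hW.disjoint_dual hFc⟩
  obtain ⟨hε, hF'k⟩ := hchain'.eq_activeCut fun W hW e he => by
    by_contra h
    exact Set.disjoint_left.1 (hFc'.disjoint_dual hW) ⟨hW.subset_ground he, hF'_zero ▸ h⟩ he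
  refine SetSeq.eq_of_forall hε hι ?_ hF'k fun k => ?_
  · rw [← hF'_zero, hF'k 0]
    exact M.dual_activeCut_zero
  · rw [← Finset.sdiff_sdiff_eq_self (hF k), hFk k]
    exact (activeFiltration_F _).symm

theorem HasBoundedMinors.isConnectedFiltration (hb : M.HasBoundedMinors S)
    (hS : M.IsFiltration S) : M.IsConnectedFiltration S where
  toIsFiltration := hS
  connected k := by
    obtain ⟨p, -, hp⟩ := hb.1 k
    exact ⟨hp.isConnected, hp.2.1.not_isLoop⟩
  connected' k := by
    obtain ⟨p, -, hp⟩ := hb.2 k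
    exact ⟨hp.isConnected, hp.2.1.not_isIsthmus⟩

end Filtrations

section Reorientations

variable {α : Type*}

section Flip

variable [DecidableEq α] {M : OrientedMatroid α} {A : Finset α} {P : Set α → Prop}

theorem mem_reorient_covectors {X : SignedSet α} :
    X ∈ (M.reorient A).covectors ↔ X.flip A ∈ M.covectors :=
  Iff.rfl

theorem mem_reorient_vectors {X : SignedSet α} :
    X ∈ (M.reorient A).vectors ↔ X.flip A ∈ M.vectors := by
  simp only [vectors, Set.mem_ofPred_eq, supp_flip]
  refine and_congr_right fun _ => ?_
  rw [(flip_involutive A).surjective.forall]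
  simp only [mem_reorient_covectors, flip_involutive A _]
  exact forall₂_congr fun Y _ => by rw [← flip_orth_flip (A := A), flip_involutive A Y]

theorem reorient_dual (M : OrientedMatroid α) (A : Finset α) :
    (M.reorient A).dual = M.dual.reorient A :=
  ext_covectors rfl (Set.ext fun _ => mem_reorient_vectors)

theorem reorient_minor (M : OrientedMatroid α) (A G F : Finset α) :
    (M.reorient A).minor G F = (M.minor G F).reorient A := by
  refine ext_covectors rfl (Set.ext fun X => and_congr ?_ ?_)
  · refine ((flip_involutive A).surjective.exists
      (p := fun Y => Y ∈ (M.reorient A).covectors ∧ restr G Y = X)).trans ?_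
    simp only [mem_reorient_covectors, flip_involutive A _, restr_flip, (flip_involutive A).eq_iff]
    rfl
  · simp only [flip_eq_zero_iff]

theorem isCocircuit_reorient {D : SignedSet α} :
    (M.reorient A).IsCocircuit D ↔ M.IsCocircuit (D.flip A) := by
  refine and_congr_right fun _ => and_congr ?_ ?_
  · simp only [ne_eq, ← supp_eq_empty_iff, supp_flip]
  · conv_rhs => rw [(flip_involutive A).surjective.forall]
    refine forall₂_congr fun X _ => ?_
    simp only [ne_eq, ← supp_eq_empty_iff, supp_flip]

theorem isCircuit_reorient {C : SignedSet α} :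
    (M.reorient A).IsCircuit C ↔ M.IsCircuit (C.flip A) := by
  change (M.reorient A).dual.IsCocircuit C ↔ _
  rw [reorient_dual]
  exact isCocircuit_reorient

theorem exists_isCocircuit_reorient :
    (∃ D, (M.reorient A).IsCocircuit D ∧ P D.supp) ↔ ∃ D, M.IsCocircuit D ∧ P D.supp := by
  conv_rhs => rw [(flip_involutive A).surjective.exists]
  simp only [isCocircuit_reorient, supp_flip]

theorem exists_isCircuit_reorient :
    (∃ C, (M.reorient A).IsCircuit C ∧ P C.supp) ↔ ∃ C, M.IsCircuit C ∧ P C.supp := by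
  conv_rhs => rw [(flip_involutive A).surjective.exists]
  simp only [isCircuit_reorient, supp_flip]

theorem isConnected_reorient : (M.reorient A).IsConnected ↔ M.IsConnected :=
  forall₂_congr fun e _ => forall₃_congr fun f _ _ =>
    exists_isCircuit_reorient (P := fun T => e ∈ T ∧ f ∈ T)

theorem isLoop_reorient : (M.reorient A).IsLoop ↔ M.IsLoop :=
  exists_congr fun _ => and_congr_right' (exists_isCircuit_reorient (P := (· = _)))

theorem isIsthmus_reorient : (M.reorient A).IsIsthmus ↔ M.IsIsthmus :=
  exists_congr fun _ => and_congr_right' (exists_isCocircuit_reorient (P := (· = _)))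

end Flip

variable [LinearOrder α] {M : OrientedMatroid α} {A : Finset α} {S : SetSeq α}

theorem isFiltration_reorient : (M.reorient A).IsFiltration S ↔ M.IsFiltration S :=
  ⟨fun h => { h with F_last := h.F_last }, fun h => { h with F_last := h.F_last }⟩

theorem isConnectedFiltration_reorient :
    (M.reorient A).IsConnectedFiltration S ↔ M.IsConnectedFiltration S := by
  constructor
  · rintro ⟨hS, hconn, hconn'⟩
    simp only [reorient_minor, isConnected_reorient, isLoop_reorient, isIsthmus_reorient]
      at hconn hconn'
    exact ⟨isFiltration_reorient.1 hS, hconn, hconn'⟩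
  · rintro ⟨hS, hconn, hconn'⟩
    refine ⟨isFiltration_reorient.2 hS, ?_, ?_⟩ <;>
      simpa only [reorient_minor, isConnected_reorient, isLoop_reorient, isIsthmus_reorient]

end Reorientations

end OrientedMatroid

theorem theorem4p6 {α : Type*} [LinearOrder α] (M : OrientedMatroid α) :
    (M.reorientations =
      ⋃ S ∈ {S : SetSeq α | M.IsConnectedFiltration S}, M.boundedReorientations S) ∧
    {S : SetSeq α | M.IsConnectedFiltration S}.PairwiseDisjoint M.boundedReorientations ∧
    ∀ S : SetSeq α, M.IsConnectedFiltration S → ∀ A ∈ M.boundedReorientations S,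
      S = (M.reorient A).activeFiltration := by
  have eq_active : ∀ S : SetSeq α, M.IsConnectedFiltration S → ∀ A ∈ M.boundedReorientations S,
      S = (M.reorient A).activeFiltration := fun S hS A hA =>
    hA.2.eq_activeFiltration (OrientedMatroid.isFiltration_reorient.2 hS.toIsFiltration)
  refine ⟨Set.Subset.antisymm (fun A hA => ?_) ?_, fun S hS T hT hST => ?_, eq_active⟩
  · obtain ⟨hfilt, hbdd⟩ := (M.reorient A).isFiltration_activeFiltration_and_hasBoundedMinors
    have hconn := OrientedMatroid.isConnectedFiltration_reorient.1
      (hbdd.isConnectedFiltration hfilt)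
    exact Set.mem_biUnion hconn ⟨hA, hbdd⟩
  · exact Set.iUnion₂_subset fun S _ A hA => hA.1
  · refine Set.disjoint_left.2 fun A hAS hAT => hST ?_
    rw [eq_active S hS A hAS, eq_active T hT A hAT]
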